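/- Let $K$ be a number field of degree $n$ with ring of integers $\mathcal O_K$, let $\mathrm N$ be the absolute norm of ideals, and for an integer $N\ge 3$ let $\mathcal I_{\le N}$ be the set of non-zero ideals of $\mathcal O_K$ of norm $\le N$. Let $\tau(\mathfrak c)$ be the number of ideals dividing $\mathfrak c$. *Functions to be decomposed.* $\Lambda_K(\mathfrak c)=\log \mathrm N(\mathfrak p)$ if $\mathfrak c=\mathfrak p^m$ with $\mathfrak p$ a non-zero prime ideal and $m\ge 1$, and $\Lambda_K(\mathfrak c)=0$ otherwise. Let $Q=e^{\sqrt{\log N}/B}$ with a parameter $B\ge 1$, let $P(Q)=\prod_{p<Q}p$ (prime numbers $p$) and $\varphi(P(Q))=\#(\mathcal O_K/(P(Q)))^\times$. Put $$\Lambda_{\text{Cramér}}(\mathfrak c)=\frac{1}{\operatorname{Res}_{s=1}\zeta_K(s)}\cdot\frac{P(Q)^n}{\varphi(P(Q))}\ \text{ if } \mathfrak c+(P(Q))=\mathcal O_K,\qquad \Lambda_{\text{Cramér}}(\mathfrak c)=0 \text{ otherwise.}$$ Let $0<\kappa<1$. A $Q$-Siegel pair $(\psi,\beta)$ (with respect to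 $\kappa$) consists of a Hecke character $\psi$ of $K$ (a continuous character of the idele class group with values in the unit circle) that takes only the values $\pm1$ and whose conductor $\mathfrak q$ has norm $<Q$, and of a real zero $\beta$ of $L(\psi,s)$ with $1-\frac{\kappa}{\log (4Q)}<\beta<1$. Write $\psi([\mathfrak c])$ for the value of $\psi$ at the class of an ideal $\mathfrak c$ coprime to $\mathfrak q$, and $\psi([\mathfrak c])=0$ if $\mathfrak c$ is not coprime to $\mathfrak q$. Given a $Q$-Siegel pair put $$\Lambda_{\text{Siegel}}(\mathfrak c)=\Lambda_{\text{Cramér}}(\mathfrak c)\bigl(1-\psi([\mathfrak c])\,\mathrm N(\mathfrak c)^{\beta-1}\bigr);$$ if there is none, put $\Lambda_{\text{Siegel}}=\Lambda_{\text{Cramér}}$. *Types of sums.* A function $A:\mathcal I_{\le N}\to\mathbb C$ is log-bounded if $|A|\le\log N$ everywhere. A function $S:\mathcal I_{\le N}\to\mathbb C$ is * a type I sum if $S(\mathfrak c)=1_{\mathrm N(\mathfrak c)\le N'}\sum_{\mathfrak d\mid\mathfrak c,\ \mathrm N(\mathfrak d)\le N^{2/3}}A(\mathfrak d)$ for some log-bounded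 $A$ and some $N'\le N$; * a twisted type I sum if $S(\mathfrak c)=\psi([\mathfrak c])\,S'(\mathfrak c)$ for a type I sum $S'$, where $(\psi,\beta)$ is the Siegel pair (there are no twisted type I sums if there is no Siegel pair); * a type II sum if $S(\mathfrak c)=\sum_{\mathfrak d_1\mathfrak d_2=\mathfrak c,\ \mathrm N(\mathfrak d_1),\mathrm N(\mathfrak d_2)>N^{1/3}}L(\mathfrak d_1)T(\mathfrak d_2)$ for some $L,T:\mathcal I_{\le N}\to\mathbb C$ with $|L|\le\log N$ and $|T|\le\tau$; * negligible if it is log-bounded and $\sum_{\mathfrak c\in\mathcal I_{\le N}}|S(\mathfrak c)|<N\exp(-\tfrac1{10}\sqrt{\log N})$. *Statement.* There are constants $C$ and $N_0$ depending only on $K$ such that for every integer $N\ge\max(3,N_0)$, every $B\ge1$, every $0<\kappa<1$ and every $Q$-Siegel pair (if there is one), each of the functions $\Lambda_K$, $\Lambda_{\text{Cramér}}$, $\Lambda_{\text{Siegel}}$ restricted to $\mathcal I_{\le N}$ is a finite $\mathbb C$-linear combination $\sum_{i\in I}c_iS_i$ with $\sum_{i\in I}|c_i|\le C\log N$ in which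 each $S_i:\mathcal I_{\le N}\to\mathbb C$ is a type I sum, a twisted type I sum, a type II sum or negligible; twisted type I sums are used only for $\Lambda_{\text{Siegel}}$. -/

import Mathlib

open NumberField IsDedekindDomain

namespace Vaughan

noncomputable section

variable (K : Type*) [Field K] [NumberField K]

/-! ### Ideals of bounded norm, type I / type II / negligible sums -/

/-- The nonzero integral ideals of `K` of norm at most `N`. -/
abbrev IdealsLE (N : ℕ) : Type _ :=
  {c : Ideal (𝓞 K) // c ≠ ⊥ ∧ Ideal.absNorm c ≤ N}

instance (N : ℕ) : Finite (IdealsLE K N) :=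
  ((Ideal.finite_setOfPred_absNorm_le (S := 𝓞 K) N).subset fun _ h => h.2).to_subtype

instance (N : ℕ) : Fintype (IdealsLE K N) := Fintype.ofFinite _

variable {K}

/-- The divisor function on nonzero ideals. -/
def tau (c : Ideal (𝓞 K)) : ℕ := Nat.card {d : Ideal (𝓞 K) // d ∣ c}

/-- `|A(c)| ≤ log N` for all nonzero ideals `c` of norm at most `N`. -/
def LogBounded {N : ℕ} (A : IdealsLE K N → ℂ) : Prop :=
  ∀ c, ‖A c‖ ≤ Real.log N

open Classical in
/-- The divisor sum `1_{N(c) ≤ N'} ∑_{N(d) ≤ N^{2/3}, d ∣ c} A(d)`. -/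
def typeOneSum {N : ℕ} (A : IdealsLE K N → ℂ) (N' : ℝ) (c : IdealsLE K N) : ℂ :=
  if (Ideal.absNorm c.1 : ℝ) ≤ N' then
    ∑ d : IdealsLE K N,
      if (Ideal.absNorm d.1 : ℝ) ≤ (N : ℝ) ^ (2 / 3 : ℝ) ∧ d.1 ∣ c.1 then A d else 0
  else 0

/-- Type I sums. -/
def IsTypeOne {N : ℕ} (S : IdealsLE K N → ℂ) : Prop :=
  ∃ (A : IdealsLE K N → ℂ) (N' : ℝ), LogBounded A ∧ N' ≤ N ∧ ∀ c, S c = typeOneSum A N' c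

/-- Type I sums twisted by a function `χ` on ideals. -/
def IsTwistedTypeOne (χ : Ideal (𝓞 K) → ℂ) {N : ℕ} (S : IdealsLE K N → ℂ) : Prop :=
  ∃ (A : IdealsLE K N → ℂ) (N' : ℝ),
    LogBounded A ∧ N' ≤ N ∧ ∀ c, S c = χ c.1 * typeOneSum A N' c

open Classical in
/-- Type II sums. -/
def IsTypeTwo {N : ℕ} (S : IdealsLE K N → ℂ) : Prop :=
  ∃ L T : IdealsLE K N → ℂ,
    (∀ d, ‖L d‖ ≤ Real.log N) ∧ (∀ d, ‖T d‖ ≤ tau d.1) ∧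
    ∀ c, S c = ∑ d₁ : IdealsLE K N, ∑ d₂ : IdealsLE K N,
      if (N : ℝ) ^ (1 / 3 : ℝ) < Ideal.absNorm d₁.1 ∧ (N : ℝ) ^ (1 / 3 : ℝ) < Ideal.absNorm d₂.1 ∧
        d₁.1 * d₂.1 = c.1 then L d₁ * T d₂ else 0

/-- Negligible functions: log-bounded with very small `ℓ¹`-norm. -/
def IsNegligible {N : ℕ} (S : IdealsLE K N → ℂ) : Prop :=
  LogBounded S ∧ ∑ c, ‖S c‖ < N * Real.exp (-(1 / 10) * Real.sqrt (Real.log N))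

/-- `f` is a finite linear combination `∑ cᵢ Sᵢ` with `∑ |cᵢ| ≤ M` and all `Sᵢ` satisfying `P`. -/
def IsCombination {N : ℕ} (P : (IdealsLE K N → ℂ) → Prop) (M : ℝ) (f : IdealsLE K N → ℂ) : Prop :=
  ∃ (m : ℕ) (a : Fin m → ℂ) (S : Fin m → IdealsLE K N → ℂ),
    ∑ i, ‖a i‖ ≤ M ∧ (∀ i, P (S i)) ∧ ∀ c, f c = ∑ i, a i * S i c

/-! ### The von Mangoldt function and its Cramér model -/

open Classical in
/-- The von Mangoldt function: `log N(p)` on powers `p ^ m`, `m ≥ 1`, of a nonzero prime ideal `p`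
(which is unique), and `0` on the other ideals. -/
def mangoldt (c : Ideal (𝓞 K)) : ℝ :=
  if h : IsPrimePow c then Real.log (Ideal.absNorm h.choose) else 0

/-- The sieve level `Q = exp (√(log N) / B)`. -/
def sieveLevel (B : ℝ) (N : ℕ) : ℝ := Real.exp (Real.sqrt (Real.log N) / B)

/-- The product of the prime numbers `p < z`. -/
def primeProd (z : ℝ) : ℕ := ∏ p ∈ Nat.primesBelow ⌈z⌉₊, p

variable (K) in
/-- The number of invertible residue classes modulo `m` in the ring of integers. -/
def totient (m : ℕ) : ℕ := Nat.card (𝓞 K ⧸ Ideal.span {(m : 𝓞 K)})ˣ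

open Classical in
/-- The Cramér model with sieve level `Q`. -/
def cramer (Q : ℝ) (c : Ideal (𝓞 K)) : ℝ :=
  if c ⊔ Ideal.span {(primeProd Q : 𝓞 K)} = ⊤ then
    1 / dedekindZeta_residue K *
      ((primeProd Q : ℝ) ^ Module.finrank ℚ K / totient K (primeProd Q))
  else 0

/-! ### Hecke characters -/

variable (K) in
/-- The idele group, with its usual topology. -/
abbrev Ideles : Type _ := (AdeleRing (𝓞 K) K)ˣ

/-- The archimedean component of an idele. -/
def Ideles.inf (x : Ideles K) : InfiniteAdeleRing K := (x : AdeleRing (𝓞 K) K).1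

/-- The component of an idele at a finite place. -/
def Ideles.fin (x : Ideles K) (v : HeightOneSpectrum (𝓞 K)) : v.adicCompletion K :=
  (x : AdeleRing (𝓞 K) K).2 v

variable (K) in
/-- Hecke characters: continuous homomorphisms from the idele group to the unit circle that are
trivial on `Kˣ`. -/
structure HeckeCharacter where
  toHom : Ideles K →* Circle
  continuous_toHom : Continuous toHom
  map_principal : ∀ x : Kˣ, toHom (Units.map (algebraMap K (AdeleRing (𝓞 K) K)) x) = 1

/-- `ψ` is a Hecke character modulo `q`: it is trivial on the ideles that are `1` at infinity,
congruent to `1` modulo `p ^ v_p(q)` for `p ∣ q`, and units at all other `p`. -/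
def HeckeCharacter.IsModulus (ψ : HeckeCharacter K) (q : Ideal (𝓞 K)) : Prop :=
  q ≠ ⊥ ∧ ∀ x : Ideles K, x.inf = 1 →
    (∀ v : HeightOneSpectrum (𝓞 K), v.asIdeal ∣ q →
      Valued.v (x.fin v - 1) ≤ WithZero.exp (-(multiplicity v.asIdeal q : ℤ))) →
    (∀ v : HeightOneSpectrum (𝓞 K), ¬ v.asIdeal ∣ q → Valued.v (x.fin v) = 1) →
    ψ.toHom x = 1

/-- `q` is the conductor of `ψ`: the largest ideal modulo which `ψ` is defined. -/
def HeckeCharacter.IsConductor (ψ : HeckeCharacter K) (q : Ideal (𝓞 K)) : Prop :=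
  ψ.IsModulus q ∧ ∀ q' : Ideal (𝓞 K), ψ.IsModulus q' → q' ≤ q

/-- The idele `x` represents the class of the ideal `c` modulo `q`: it is `1` at infinity and at
the primes dividing `q`, and has valuation `v_p(c)` at every prime `p`. -/
def Represents (q c : Ideal (𝓞 K)) (x : Ideles K) : Prop :=
  x.inf = 1 ∧ ∀ v : HeightOneSpectrum (𝓞 K),
    (v.asIdeal ∣ q → x.fin v = 1) ∧
    Valued.v (x.fin v) = WithZero.exp (-(multiplicity v.asIdeal c : ℤ))

theorem exists_represents {q c : Ideal (𝓞 K)} (hc : c ≠ ⊥) (h : IsCoprime c q) :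
    ∃ x : Ideles K, Represents q c x := by
  classical
  choose π hπ using fun v : HeightOneSpectrum (𝓞 K) => v.valuation_exists_uniformizer K
  have hmul : ∀ v : HeightOneSpectrum (𝓞 K), ¬ v.asIdeal ∣ c → multiplicity v.asIdeal c = 0 :=
    fun v hv => multiplicity_eq_zero.2 hv
  let a : (v : HeightOneSpectrum (𝓞 K)) → v.adicCompletion K := fun v =>
    if v.asIdeal ∣ c then ((π v ^ multiplicity v.asIdeal c : K) : v.adicCompletion K) else 1
  have hval : ∀ v, Valued.v (a v) = WithZero.exp (-(multiplicity v.asIdeal c : ℤ)) := by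
    intro v
    by_cases hv : v.asIdeal ∣ c
    · simp only [a, if_pos hv]
      rw [HeightOneSpectrum.valuedAdicCompletion_eq_valuation', map_pow, hπ, ← WithZero.exp_nsmul]
      simp
    · simp [a, if_neg hv, hmul v hv]
  have hfin : {v : HeightOneSpectrum (𝓞 K) | v.asIdeal ∣ c}.Finite := Ideal.finite_factors hc
  have hone : ∀ᶠ v in Filter.cofinite, Valued.v (a v) = 1 := by
    refine hfin.subset fun v hv => ?_
    by_contra hvc
    refine hv ?_
    change Valued.v (a v) = 1
    rw [hval v, hmul v hvc]
    simp
  let b : FiniteAdeleRing (𝓞 K) K := ⟨a, by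
    filter_upwards [hone] with v hv
    exact (HeightOneSpectrum.mem_adicCompletionIntegers (𝓞 K) K v).2 hv.le⟩
  have hb : IsUnit b := by
    rw [FiniteAdeleRing.isUnit_iff]
    refine ⟨fun v h0 => ?_, hone⟩
    have h1 := hval v
    rw [show a v = 0 from h0, map_zero] at h1
    exact WithZero.exp_ne_zero h1.symm
  refine ⟨(MulEquiv.prodUnits.symm (1, hb.unit) :
    (InfiniteAdeleRing K × FiniteAdeleRing (𝓞 K) K)ˣ), rfl, fun v => ⟨fun hq => ?_, hval v⟩⟩
  have hvc : ¬ v.asIdeal ∣ c := fun hvc =>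
    v.isPrime.ne_top (Ideal.isUnit_iff.1 (h.isUnit_of_dvd' hvc hq))
  change a v = 1
  simp [a, if_neg hvc]

open Classical in
/-- The value `ψ([c])`, extended by `0` to the ideals not coprime to `q`. For `q` the conductor of
`ψ` it does not depend on the representing idele. -/
def HeckeCharacter.idealValue (ψ : HeckeCharacter K) (q c : Ideal (𝓞 K)) : ℂ :=
  if h : c ≠ ⊥ ∧ IsCoprime c q then (ψ.toHom (exists_represents h.1 h.2).choose : ℂ) else 0

theorem HeckeCharacter.idealValue_eq {ψ : HeckeCharacter K} {q c : Ideal (𝓞 K)}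
    (hψ : ψ.IsModulus q) (hc : c ≠ ⊥) (h : IsCoprime c q) {x : Ideles K} (hx : Represents q c x) :
    ψ.idealValue q c = ψ.toHom x := by
  have hh : c ≠ ⊥ ∧ IsCoprime c q := ⟨hc, h⟩
  rw [HeckeCharacter.idealValue, dif_pos hh]
  have hy := (exists_represents hh.1 hh.2).choose_spec
  set y := (exists_represents hh.1 hh.2).choose
  have hinf : ∀ u w : Ideles K, (u * w).inf = u.inf * w.inf := fun _ _ => rfl
  have hfin : ∀ (u w : Ideles K) v, (u * w).fin v = u.fin v * w.fin v := fun _ _ _ => rfl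
  have e1 : (x⁻¹ * y) * x = y := by rw [mul_comm, mul_inv_cancel_left]
  have key : ψ.toHom (x⁻¹ * y) = 1 := by
    refine hψ.2 _ ?_ (fun v hv => ?_) (fun v _ => ?_)
    · have := hinf (x⁻¹ * y) x
      rwa [e1, hx.1, hy.1, mul_one, eq_comm] at this
    · have := hfin (x⁻¹ * y) x v
      rw [e1, (hx.2 v).1 hv, (hy.2 v).1 hv, mul_one] at this
      simp [← this]
    · have := congrArg Valued.v (hfin (x⁻¹ * y) x v)
      rw [e1, map_mul, (hx.2 v).2, (hy.2 v).2] at this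
      exact (mul_eq_right₀ (by simp)).1 this.symm
  rw [← e1, map_mul, key, one_mul]

/-- The Hecke `L`-series `∑ ψ([c]) N(c)^{-s}` over the nonzero ideals `c`, for `Re s > 1`. -/
def HeckeCharacter.lSeries (ψ : HeckeCharacter K) (q : Ideal (𝓞 K)) (s : ℂ) : ℂ :=
  ∑' c : {c : Ideal (𝓞 K) // c ≠ ⊥}, ψ.idealValue q c.1 * (Ideal.absNorm c.1 : ℂ) ^ (-s)

/-- The meromorphic continuation of the `L`-series of `ψ` to `ℂ` is holomorphic and vanishes
at `ρ`. -/
def HeckeCharacter.HasLZero (ψ : HeckeCharacter K) (q : Ideal (𝓞 K)) (ρ : ℂ) : Prop :=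
  ∃ F : ℂ → ℂ, Meromorphic F ∧ (∀ s : ℂ, 1 < s.re → F s = ψ.lSeries q s) ∧
    AnalyticAt ℂ F ρ ∧ F ρ = 0

/-! ### The Siegel model -/

variable (K) in
/-- A Siegel character and Siegel zero for the level `Q` and the constant `κ`: a real Hecke
character of conductor of norm `< Q`, with a real zero `β < 1` of its `L`-function in the region
`σ > 1 - κ / (log Q + log (|t| + 4))`. -/
structure SiegelZero (κ Q : ℝ) where
  char : HeckeCharacter K
  cond : Ideal (𝓞 K)
  beta : ℝ
  isConductor : char.IsConductor cond
  norm_cond_lt : (Ideal.absNorm cond : ℝ) < Q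
  real : ∀ x, (char.toHom x : ℂ) = 1 ∨ (char.toHom x : ℂ) = -1
  hasLZero : char.HasLZero cond beta
  lt_beta : 1 - κ / (Real.log Q + Real.log 4) < beta
  beta_lt_one : beta < 1

/-- The Siegel model. `none` stands for the case where there is no Siegel zero, in which the Siegel
model is the Cramér model. -/
def siegel {κ Q : ℝ} : Option (SiegelZero K κ Q) → Ideal (𝓞 K) → ℂ
  | none, c => cramer Q c
  | some z, c => cramer Q c *
      (1 - z.char.idealValue z.cond c * (((Ideal.absNorm c : ℝ) ^ (z.beta - 1) : ℝ) : ℂ))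

/-- Type I sums twisted by the Siegel character; there are none if there is no Siegel zero. -/
def IsSiegelTwisted {κ Q : ℝ} {N : ℕ} (S : IdealsLE K N → ℂ) : Option (SiegelZero K κ Q) → Prop
  | none => False
  | some z => IsTwistedTypeOne (z.char.idealValue z.cond) S

end

end Vaughan

namespace Vaughan

noncomputable section

/-! ### Finite linear combinations with a bound on the coefficients -/

/-- `f` is a finite linear combination `∑ aᵢ Sᵢ` of functions satisfying `P` with
`∑ |aᵢ| ≤ M`. -/
def HasMass {X : Type*} (P : (X → ℂ) → Prop) (M : ℝ) (f : X → ℂ) : Prop :=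
  ∃ (m : ℕ) (a : Fin m → ℂ) (S : Fin m → X → ℂ),
    ∑ i, ‖a i‖ ≤ M ∧ (∀ i, P (S i)) ∧ ∀ x, f x = ∑ i, a i * S i x

namespace HasMass

variable {X Y : Type*} {P P' : (X → ℂ) → Prop} {M M' : ℝ} {f g : X → ℂ}

theorem of_fintype {ι : Type*} [Fintype ι] (a : ι → ℂ) (S : ι → X → ℂ) (ha : ∑ i, ‖a i‖ ≤ M)
    (hS : ∀ i, P (S i)) (hf : ∀ x, f x = ∑ i, a i * S i x) : HasMass P M f := by
  let e := (Fintype.equivFin ι).symm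
  refine ⟨_, a ∘ e, S ∘ e, ?_, fun i => hS _, fun x => ?_⟩
  · exact (e.sum_comp fun i => ‖a i‖).le.trans ha
  · exact (hf x).trans (e.sum_comp fun i => a i * S i x).symm

theorem of_mem (h : P f) : HasMass P 1 f :=
  of_fintype (ι := Unit) (fun _ => 1) (fun _ => f) (by simp) (fun _ => h) (by simp)

theorem mono (h : HasMass P M f) (hM : M ≤ M') (hP : ∀ S, P S → P' S) : HasMass P' M' f := by
  obtain ⟨m, a, S, ha, hS, hf⟩ := h
  exact ⟨m, a, S, ha.trans hM, fun i => hP _ (hS i), hf⟩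

theorem add (hf : HasMass P M f) (hg : HasMass P M' g) :
    HasMass P (M + M') (fun x => f x + g x) := by
  obtain ⟨m, a, S, ha, hS, hf⟩ := hf
  obtain ⟨m', a', S', ha', hS', hg⟩ := hg
  refine of_fintype (ι := Fin m ⊕ Fin m') (Sum.elim a a') (Sum.elim S S') ?_ ?_ ?_
  · simpa using add_le_add ha ha'
  · rintro (i | i)
    exacts [hS i, hS' i]
  · intro x
    simp [hf, hg]

theorem const_mul (z : ℂ) (hf : HasMass P M f) : HasMass P (‖z‖ * M) (fun x => z * f x) := by
  obtain ⟨m, a, S, ha, hS, hf⟩ := hf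
  refine ⟨m, fun i => z * a i, S, ?_, hS, fun x => ?_⟩
  · simp only [norm_mul, ← Finset.mul_sum]
    gcongr
  · simp only [hf, Finset.mul_sum, mul_assoc]

/-- Transport of a combination along a linear operation on functions. -/
theorem map {Q : (Y → ℂ) → Prop} {g : Y → ℂ} (hf : HasMass P M f) (k : Y → X → ℂ) (s : Finset X)
    (hQ : ∀ S, P S → Q (fun y => ∑ x ∈ s, k y x * S x))
    (hg : ∀ y, g y = ∑ x ∈ s, k y x * f x) : HasMass Q M g := by
  obtain ⟨m, a, S, ha, hS, hf⟩ := hf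
  refine ⟨m, a, _, ha, fun i => hQ _ (hS i), fun y => ?_⟩
  simp only [hg, hf, Finset.mul_sum]
  rw [Finset.sum_comm]
  exact Finset.sum_congr rfl fun i _ => Finset.sum_congr rfl fun x _ => by ring

theorem mul (hf : HasMass P M f) (hg : HasMass P M' g) (hM : 0 ≤ M)
    (hP : ∀ S T, P S → P T → P (fun x => S x * T x)) :
    HasMass P (M * M') (fun x => f x * g x) := by
  obtain ⟨m, a, S, ha, hS, hf⟩ := hf
  obtain ⟨m', a', S', ha', hS', hg⟩ := hg
  refine of_fintype (ι := Fin m × Fin m') (fun i => a i.1 * a' i.2)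
    (fun i x => S i.1 x * S' i.2 x) ?_ (fun i => hP _ _ (hS _) (hS' _)) fun x => ?_
  · simp only [norm_mul]
    rw [Fintype.sum_prod_type]
    dsimp only
    rw [← Finset.sum_mul_sum]
    gcongr
  · simp only [hf, hg]
    rw [Fintype.sum_prod_type, Finset.sum_mul_sum]
    exact Finset.sum_congr rfl fun i _ => Finset.sum_congr rfl fun x _ => by ring

end HasMass

/-! ### Separation of variables -/

theorem norm_ite_one_zero_le (p : Prop) [Decidable p] : ‖(if p then 1 else 0 : ℂ)‖ ≤ 1 := by
  split_ifs <;> simp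

/-- Products `u(x) v(y)` of functions bounded by `1`. -/
def IsProductFun {X Y : Type*} (F : X × Y → ℂ) : Prop :=
  ∃ (u : X → ℂ) (v : Y → ℂ), (∀ x, ‖u x‖ ≤ 1) ∧ (∀ y, ‖v y‖ ≤ 1) ∧ ∀ z, F z = u z.1 * v z.2

namespace IsProductFun

variable {X Y X' Y' : Type*}

theorem mul {F G : X × Y → ℂ} (hF : IsProductFun F) (hG : IsProductFun G) :
    IsProductFun (fun z => F z * G z) := by
  obtain ⟨u, v, hu, hv, h⟩ := hF
  obtain ⟨u', v', hu', hv', h'⟩ := hG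
  refine ⟨fun x => u x * u' x, fun y => v y * v' y, fun x => ?_, fun y => ?_, fun z => ?_⟩
  · rw [norm_mul]
    exact mul_le_one₀ (hu x) (norm_nonneg _) (hu' x)
  · rw [norm_mul]
    exact mul_le_one₀ (hv y) (norm_nonneg _) (hv' y)
  · simp only [h, h']
    ring

theorem comp {F : X × Y → ℂ} (hF : IsProductFun F) (i : X' → X) (j : Y' → Y) :
    IsProductFun (fun z => F (i z.1, j z.2)) := by
  obtain ⟨u, v, hu, hv, h⟩ := hF
  exact ⟨u ∘ i, v ∘ j, fun x => hu _, fun y => hv _, fun z => h _⟩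

end IsProductFun

theorem HasMass.comp_prod {X Y X' Y' : Type*} {F : X × Y → ℂ} {M : ℝ}
    (hF : HasMass IsProductFun M F) (i : X' → X) (j : Y' → Y) :
    HasMass IsProductFun M (fun z : X' × Y' => F (i z.1, j z.2)) := by
  obtain ⟨m, a, S, ha, hS, hf⟩ := hF
  exact ⟨m, a, fun k z => S k (i z.1, j z.2), ha, fun k => (hS k).comp i j, fun z => hf _⟩

/-- The relation `x ≤ y` between numbers with `k` binary digits separates with mass `k + 1`. -/
theorem hasMass_le (k : ℕ) :
    HasMass IsProductFun (k + 1)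
      (fun z : Fin (2 ^ k) × Fin (2 ^ k) => if z.1 ≤ z.2 then (1 : ℂ) else 0) := by
  induction k with
  | zero =>
    refine (HasMass.of_mem ⟨fun _ => 1, fun _ => 1, by simp, by simp, ?_⟩).mono (by simp)
      fun _ h => h
    rintro ⟨x, y⟩
    simp
  | succ k ih =>
    let low : Fin (2 ^ (k + 1)) → Fin (2 ^ k) := fun x => ⟨x % 2 ^ k, Nat.mod_lt _ (by positivity)⟩
    let top : Fin (2 ^ (k + 1)) → ℕ := fun x => x / 2 ^ k
    have htop : ∀ x, top x < 2 := fun x => by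
      rw [Nat.div_lt_iff_lt_mul (by positivity)]
      calc (x : ℕ) < 2 ^ (k + 1) := x.2
        _ = 2 * 2 ^ k := by ring
    have heq : HasMass IsProductFun 1
        (fun z : Fin (2 ^ (k + 1)) × Fin (2 ^ (k + 1)) =>
          if top z.1 = top z.2 then (1 : ℂ) else 0) := by
      refine HasMass.of_fintype (ι := Fin 2) (fun _ => 1 / 2)
        (fun i z => (-1) ^ (i * top z.1 : ℕ) * (-1) ^ (i * top z.2 : ℕ)) (by norm_num)
        (fun i => ⟨fun x => (-1) ^ (i * top x : ℕ), fun x => (-1) ^ (i * top x : ℕ),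
          by simp, by simp, fun _ => rfl⟩) fun z => ?_
      have h1 := htop z.1
      have h2 := htop z.2
      rw [Fin.sum_univ_two]
      interval_cases top z.1 <;> interval_cases top z.2 <;> norm_num
    have hlt : HasMass IsProductFun 1
        (fun z : Fin (2 ^ (k + 1)) × Fin (2 ^ (k + 1)) =>
          if top z.1 < top z.2 then (1 : ℂ) else 0) := by
      refine HasMass.of_mem ⟨fun x => if top x = 0 then 1 else 0,
        fun x => if top x = 1 then 1 else 0, fun x => norm_ite_one_zero_le _,
        fun x => norm_ite_one_zero_le _, fun z => ?_⟩
      have h1 := htop z.1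
      have h2 := htop z.2
      dsimp only
      generalize top z.1 = t₁ at *
      generalize top z.2 = t₂ at *
      interval_cases t₁ <;> interval_cases t₂ <;> norm_num
    have hcomb := hlt.add (heq.mul (ih.comp_prod low low) zero_le_one fun _ _ => IsProductFun.mul)
    convert hcomb.mono (M' := ((k + 1 : ℕ) : ℝ) + 1) (by push_cast; linarith) fun _ h => h
      using 2 with z
    obtain ⟨x, y⟩ := z
    have hx := Nat.div_add_mod (x : ℕ) (2 ^ k)
    have hy := Nat.div_add_mod (y : ℕ) (2 ^ k)
    have hlx : (low x : ℕ) < 2 ^ k := (low x).2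
    have hly : (low y : ℕ) < 2 ^ k := (low y).2
    change 2 ^ k * top x + (low x : ℕ) = x at hx
    change 2 ^ k * top y + (low y : ℕ) = y at hy
    have h1 := htop x
    have h2 := htop y
    have hxy : x ≤ y ↔ (x : ℕ) ≤ y := Iff.rfl
    have hll : low x ≤ low y ↔ (low x : ℕ) ≤ low y := Iff.rfl
    simp only [hxy, ← hx, ← hy, hll]
    generalize (low x : ℕ) = l₁ at *
    generalize (low y : ℕ) = l₂ at *
    generalize top x = t₁ at *
    generalize top y = t₂ at *
    interval_cases t₁ <;> interval_cases t₂ <;> simp <;> omega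

/-- A bounded Lipschitz function of `log x + log y`, for positive integers `x ≤ N` and `y`,
separates with bounded mass. -/
theorem hasMass_lipschitz {W : ℝ → ℝ} {δ : ℝ} (hδ : 0 < δ) (hW : ∀ u, |W u| ≤ 1)
    (hL : ∀ u v, |W u - W v| ≤ δ * |u - v|) {N : ℕ} (hN : 1 ≤ N) {X Y : Type*} (i : X → ℕ)
    (hi : ∀ x, 1 ≤ i x ∧ i x ≤ N) (j : Y → ℝ) :
    HasMass IsProductFun (1 + δ * Real.log N)
      (fun z : X × Y => (W (Real.log (i z.1) + j z.2) : ℂ)) := by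
  have h0 : HasMass IsProductFun 1 (fun z : X × Y => (W (j z.2) : ℂ)) :=
    HasMass.of_mem ⟨fun _ => 1, fun y => W (j y), by simp, fun y => by simpa using hW (j y),
      by simp⟩
  let a : ℕ → ℝ := fun k => Real.log (k + 1 : ℕ) - Real.log k
  have ha : ∀ k, 1 ≤ k → 0 < a k := fun k hk => by
    have : (0 : ℝ) < k := by exact_mod_cast hk
    have := Real.log_lt_log this (show (k : ℝ) < (k + 1 : ℕ) by push_cast; linarith)
    simp only [a]
    linarith
  have h1 : HasMass IsProductFun (δ * Real.log N)
      (fun z : X × Y => ∑ k ∈ Finset.Ico 1 N, if k < i z.1 then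
        ((W (Real.log (k + 1 : ℕ) + j z.2) - W (Real.log k + j z.2) : ℝ) : ℂ) else 0) := by
    refine HasMass.of_fintype (ι := Finset.Ico 1 N) (fun k => ((δ * a k : ℝ) : ℂ))
      (fun k z => (if k < i z.1 then 1 else 0) *
        (((W (Real.log (k + 1 : ℕ) + j z.2) - W (Real.log k + j z.2)) / (δ * a k) : ℝ) : ℂ))
      ?_ ?_ ?_
    · rw [Finset.sum_coe_sort (Finset.Ico 1 N) (fun k => ‖((δ * a k : ℝ) : ℂ)‖)]
      have : ∀ k ∈ Finset.Ico 1 N, ‖((δ * a k : ℝ) : ℂ)‖ = δ * a k := fun k hk => by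
        rw [Complex.norm_real, Real.norm_of_nonneg]
        exact (mul_pos hδ (ha k (Finset.mem_Ico.1 hk).1)).le
      rw [Finset.sum_congr rfl this, ← Finset.mul_sum]
      simp only [a]
      rw [Finset.sum_Ico_sub (fun k : ℕ => Real.log k) hN]
      simp
    · rintro ⟨k, hk⟩
      have hk' := ha k (Finset.mem_Ico.1 hk).1
      refine ⟨fun x => if k < i x then 1 else 0, fun y =>
        (((W (Real.log (k + 1 : ℕ) + j y) - W (Real.log k + j y)) / (δ * a k) : ℝ) : ℂ),
        fun x => norm_ite_one_zero_le _, fun y => ?_, fun z => rfl⟩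
      rw [Complex.norm_real, Real.norm_eq_abs, abs_div, abs_of_pos (mul_pos hδ hk'),
        div_le_one (mul_pos hδ hk')]
      refine (hL _ _).trans_eq ?_
      rw [add_sub_add_right_eq_sub, abs_of_pos hk']
    · intro z
      rw [Finset.sum_coe_sort (Finset.Ico 1 N) (fun k => ((δ * a k : ℝ) : ℂ) *
        ((if k < i z.1 then 1 else 0) * (((W (Real.log (k + 1 : ℕ) + j z.2) -
          W (Real.log k + j z.2)) / (δ * a k) : ℝ) : ℂ)))]
      refine Finset.sum_congr rfl fun k hk => ?_
      have hk' := (mul_pos hδ (ha k (Finset.mem_Ico.1 hk).1)).ne'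
      split_ifs
      · rw [one_mul, ← Complex.ofReal_mul, mul_div_cancel₀ _ hk']
      · simp
  convert h0.add h1 using 2 with z
  obtain ⟨x, y⟩ := z
  obtain ⟨h1x, hNx⟩ := hi x
  dsimp only
  rw [← Finset.sum_filter, show (Finset.Ico 1 N).filter (fun k => k < i x) = Finset.Ico 1 (i x) by
    ext k; simp only [Finset.mem_filter, Finset.mem_Ico]; omega, ← Complex.ofReal_sum,
    Finset.sum_Ico_sub (fun k : ℕ => W (Real.log k + j y)) h1x]
  simp

/-! ### A truncated sieve identity -/

theorem sieve_identity {r : ℕ} (A : Finset (Fin r)) (w : Finset (Fin r) → ℝ)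
    (hw : ∀ B C, B ⊆ C → w B ≤ w C) {D : ℝ} (h0 : w ∅ ≤ D) :
    (if A = ∅ then (1 : ℂ) else 0) =
      ∑ B ∈ A.powerset, (if w B ≤ D then (-1) ^ B.card else 0) +
      ∑ B ∈ A.powerset, (if ∃ i ∈ B, (∀ j ∈ A, i ≤ j) ∧ D < w B ∧ w (B.erase i) ≤ D
        then (-1) ^ B.card else 0) := by
  rcases A.eq_empty_or_nonempty with rfl | hA
  · simp [h0]
  · set a := A.min' hA with ha
    have haA : a ∈ A := A.min'_mem hA
    have hmin : ∀ j ∈ A, a ≤ j := fun j hj => A.min'_le j hj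
    have hins : insert a (A.erase a) = A := Finset.insert_erase haA
    rw [if_neg hA.ne_empty, ← Finset.sum_add_distrib]
    conv_rhs => rw [← hins]
    rw [Finset.sum_powerset_insert (Finset.notMem_erase a A), ← Finset.sum_add_distrib, hins]
    refine (Finset.sum_eq_zero fun t ht => ?_).symm
    have hta : a ∉ t := fun h => Finset.notMem_erase a A (Finset.mem_powerset.1 ht h)
    have htA : ∀ i ∈ t, i ∈ A := fun i hi =>
      Finset.mem_of_mem_erase (Finset.mem_powerset.1 ht hi)
    have hmono := hw t (insert a t) (Finset.subset_insert _ _)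
    have h1 : ¬ ∃ i ∈ t, (∀ j ∈ A, i ≤ j) ∧ D < w t ∧ w (t.erase i) ≤ D := by
      rintro ⟨i, hi, hij, -⟩
      exact hta (le_antisymm (hij a haA) (hmin i (htA i hi)) ▸ hi)
    have h2 : (∃ i ∈ insert a t, (∀ j ∈ A, i ≤ j) ∧ D < w (insert a t) ∧
        w ((insert a t).erase i) ≤ D) ↔ D < w (insert a t) ∧ w t ≤ D := by
      constructor
      · rintro ⟨i, hi, hij, h, h'⟩
        have hia : i = a := le_antisymm (hij a haA)
          (hmin i ((Finset.mem_insert.1 hi).elim (fun e => e ▸ haA) (htA i)))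
        rw [hia, Finset.erase_insert hta] at h'
        exact ⟨h, h'⟩
      · rintro ⟨h, h'⟩
        exact ⟨a, Finset.mem_insert_self _ _, hmin, h, by rwa [Finset.erase_insert hta]⟩
    simp only [h1, h2, if_false, Finset.card_insert_of_notMem hta, pow_succ]
    by_cases hb : w (insert a t) ≤ D
    · simp [hb, hmono.trans hb, hb.not_gt]
    · by_cases hc : w t ≤ D <;> simp [hb, hc, not_le.1 hb]

variable {K : Type*} [Field K] [NumberField K]

/-! ### Divisors among the ideals of bounded norm -/

section Divisors

variable {N : ℕ}

theorem one_le_absNorm {c : Ideal (𝓞 K)} (hc : c ≠ ⊥) : 1 ≤ Ideal.absNorm c :=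
  Nat.one_le_iff_ne_zero.2 fun h => hc (Ideal.absNorm_eq_zero_iff.1 h)

theorem absNorm_le_of_dvd {c d : Ideal (𝓞 K)} (hc : c ≠ ⊥) (h : d ∣ c) :
    Ideal.absNorm d ≤ Ideal.absNorm c :=
  Nat.le_of_dvd (one_le_absNorm hc) (map_dvd Ideal.absNorm h)

/-- A divisor of an ideal of norm at most `N`. -/
def IdealsLE.divisor (c : IdealsLE K N) {d : Ideal (𝓞 K)} (h : d ∣ c.1) : IdealsLE K N :=
  ⟨d, ne_zero_of_dvd_ne_zero c.2.1 h, (absNorm_le_of_dvd c.2.1 h).trans c.2.2⟩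

theorem exists_cofactor {c b : IdealsLE K N} (h : b.1 ∣ c.1) :
    ∃ m : IdealsLE K N, b.1 * m.1 = c.1 ∧ ∀ d : IdealsLE K N, b.1 * d.1 = c.1 ↔ d = m := by
  obtain ⟨m, hm⟩ := h
  refine ⟨c.divisor ⟨b.1, by rw [hm, mul_comm]⟩, hm.symm, fun d => ?_⟩
  rw [Subtype.ext_iff]
  refine Iff.trans ?_ (mul_right_inj' (show b.1 ≠ 0 from b.2.1))
  exact iff_of_eq (congrArg (b.1 * d.1 = ·) hm)

theorem sum_mul_eq_ite {c b : IdealsLE K N} {m : IdealsLE K N}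
    (h : ∀ d : IdealsLE K N, b.1 * d.1 = c.1 ↔ d = m) (f : IdealsLE K N → ℂ)
    [DecidableEq (Ideal (𝓞 K))] :
    ∑ d : IdealsLE K N, (if b.1 * d.1 = c.1 then f d else 0) = f m := by
  classical
  simp [h]

open Classical in
theorem tau_eq (c : IdealsLE K N) :
    tau c.1 = (Finset.univ.filter fun a : IdealsLE K N => a.1 ∣ c.1).card := by
  rw [← Fintype.card_subtype, ← Nat.card_eq_fintype_card]
  refine Nat.card_congr ⟨fun d => ⟨c.divisor d.2, d.2⟩, fun a => ⟨a.1.1, a.2⟩, fun _ => rfl,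
    fun _ => rfl⟩

theorem one_le_tau (c : IdealsLE K N) : 1 ≤ tau c.1 := by
  classical
  rw [tau_eq]
  exact Finset.card_pos.2 ⟨c, by simp⟩

theorem one_le_log {N : ℕ} (hN : 3 ≤ N) : 1 ≤ Real.log N := by
  rw [Real.le_log_iff_exp_le (by positivity)]
  exact Real.exp_one_lt_three.le.trans (by exact_mod_cast hN)

end Divisors

/-! ### Square-free products of a family of prime ideals -/

section PrimeFamily

set_option linter.unusedSectionVars false

variable {r : ℕ} (p : Fin r → Ideal (𝓞 K))

open Classical in
/-- The indices `i` with `pᵢ ∣ c`. -/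
def labels (c : Ideal (𝓞 K)) : Finset (Fin r) := Finset.univ.filter fun i => p i ∣ c

/-- The least index `i` with `pᵢ ∣ c`, or `r` if there is none. -/
def minLabel (c : Ideal (𝓞 K)) : ℕ := sInf {k | k = r ∨ ∃ i : Fin r, p i ∣ c ∧ (i : ℕ) = k}

open Classical in
/-- The function on ideals with value `g B` at `∏_{i ∈ B} pᵢ` and `0` at the other ideals. -/
def onProducts (g : Finset (Fin r) → ℂ) (d : Ideal (𝓞 K)) : ℂ :=
  ∑ B, if ∏ i ∈ B, p i = d then g B else 0

variable {p}

theorem mem_labels {c : Ideal (𝓞 K)} {i : Fin r} : i ∈ labels p c ↔ p i ∣ c := by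
  simp [labels]

theorem minLabel_le (c : Ideal (𝓞 K)) : minLabel p c ≤ r := Nat.sInf_le (Or.inl rfl)

theorem le_minLabel_iff {c : Ideal (𝓞 K)} {k : ℕ} :
    k ≤ minLabel p c ↔ k ≤ r ∧ ∀ i ∈ labels p c, k ≤ i := by
  constructor
  · intro h
    exact ⟨h.trans (minLabel_le c), fun i hi =>
      h.trans (Nat.sInf_le (Or.inr ⟨i, mem_labels.1 hi, rfl⟩))⟩
  · rintro ⟨hr, h⟩
    refine le_csInf ⟨r, Or.inl rfl⟩ ?_
    rintro _ (rfl | ⟨i, hi, rfl⟩)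
    exacts [hr, h i (mem_labels.2 hi)]

theorem labels_mul (hp : ∀ i, Prime (p i)) (c d : Ideal (𝓞 K)) :
    labels p (c * d) = labels p c ∪ labels p d := by
  ext i
  simp [mem_labels, (hp i).dvd_mul]

theorem labels_prod (hp : ∀ i, Prime (p i)) (hinj : Function.Injective p)
    (B : Finset (Fin r)) : labels p (∏ i ∈ B, p i) = B := by
  ext i
  rw [mem_labels, (hp i).dvd_finsetProd_iff]
  constructor
  · rintro ⟨j, hj, hij⟩
    rwa [hinj (associated_iff_eq.1 ((hp i).associated_of_dvd (hp j) hij))]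
  · exact fun hi => ⟨i, hi, dvd_rfl⟩

theorem prod_dvd_iff (hp : ∀ i, Prime (p i)) (hinj : Function.Injective p)
    {B : Finset (Fin r)} {c : Ideal (𝓞 K)} :
    ∏ i ∈ B, p i ∣ c ↔ B ⊆ labels p c := by
  classical
  constructor
  · intro h i hi
    exact mem_labels.2 ((Finset.dvd_prod_of_mem p hi).trans h)
  · intro h
    rw [show ∏ i ∈ B, p i = ∏ q ∈ B.image p, q from
      (Finset.prod_image (f := fun q => q) hinj.injOn).symm]
    refine Finset.prod_primes_dvd c (fun a ha => ?_) fun a ha => ?_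
    all_goals obtain ⟨i, hi, rfl⟩ := Finset.mem_image.1 ha
    exacts [hp i, mem_labels.1 (h hi)]

theorem minLabel_prod_le_iff (hp : ∀ i, Prime (p i)) (hinj : Function.Injective p)
    {B : Finset (Fin r)} {i : Fin r} (hi : i ∈ B) (hB : ∀ j ∈ B, i ≤ j)
    {m : Ideal (𝓞 K)} :
    minLabel p (∏ i ∈ B, p i) ≤ minLabel p m ↔ ∀ j ∈ labels p ((∏ i ∈ B, p i) * m), i ≤ j := by
  have h : minLabel p (∏ i ∈ B, p i) = i := by
    refine le_antisymm (Nat.sInf_le (Or.inr ⟨i, Finset.dvd_prod_of_mem p hi, rfl⟩)) ?_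
    rw [le_minLabel_iff, labels_prod hp hinj]
    exact ⟨i.2.le, hB⟩
  rw [h, le_minLabel_iff, labels_mul hp, labels_prod hp hinj]
  constructor
  · rintro ⟨-, h⟩ j hj
    exact (Finset.mem_union.1 hj).elim (hB j) (h j)
  · exact fun h => ⟨i.2.le, fun j hj => h j (Finset.mem_union_right _ hj)⟩

theorem norm_onProducts_le (hp : ∀ i, Prime (p i)) (hinj : Function.Injective p)
    {g : Finset (Fin r) → ℂ} (hg : ∀ B, ‖g B‖ ≤ 1) (d : Ideal (𝓞 K)) :
    ‖onProducts p g d‖ ≤ 1 := by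
  classical
  have h : ∀ B : Finset (Fin r), ∏ i ∈ B, p i = d → B = labels p d := fun B hB => by
    rw [← hB, labels_prod hp hinj]
  rw [onProducts, Finset.sum_eq_single (labels p d)]
  · split_ifs
    exacts [hg _, by simp]
  · exact fun B _ hB => if_neg fun h' => hB (h B h')
  · simp

open Classical in
theorem sum_mul_onProducts (hp : ∀ i, Prime (p i)) (hinj : Function.Injective p)
    {N : ℕ} {c : IdealsLE K N} {g Y : Finset (Fin r) → ℂ}
    {X : Ideal (𝓞 K) → Ideal (𝓞 K) → ℂ}
    (h : ∀ B ⊆ labels p c.1, ∀ m, (∏ i ∈ B, p i) * m = c.1 → g B * X (∏ i ∈ B, p i) m = Y B) :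
    ∑ d₁ : IdealsLE K N, ∑ d₂ : IdealsLE K N,
      (if d₁.1 * d₂.1 = c.1 then onProducts p g d₁.1 * X d₁.1 d₂.1 else 0) =
      ∑ B ∈ (labels p c.1).powerset, Y B := by
  have h1 : ∀ d₁ d₂ : IdealsLE K N,
      (if d₁.1 * d₂.1 = c.1 then onProducts p g d₁.1 * X d₁.1 d₂.1 else 0) =
      ∑ B, if ∏ i ∈ B, p i = d₁.1 then if d₁.1 * d₂.1 = c.1 then g B * X d₁.1 d₂.1 else 0
        else 0 := by
    intro d₁ d₂
    rw [onProducts, Finset.sum_mul]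
    split_ifs
    · exact Finset.sum_congr rfl fun B _ => by rw [ite_mul, zero_mul]
    · simp
  simp only [h1]
  simp_rw [Finset.sum_comm (t := (Finset.univ : Finset (Finset (Fin r))))]
  rw [← Finset.sum_subset (Finset.subset_univ (labels p c.1).powerset)]
  · refine Finset.sum_congr rfl fun B hB => ?_
    have hB' := Finset.mem_powerset.1 hB
    have hdvd := (prod_dvd_iff hp hinj).2 hB'
    obtain ⟨m, hm, hm'⟩ := exists_cofactor (b := c.divisor hdvd) (c := c) hdvd
    rw [Finset.sum_eq_single (c.divisor hdvd)]
    · simp only [IdealsLE.divisor, if_true]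
      exact (sum_mul_eq_ite hm' _).trans (h B hB' _ hm)
    · exact fun d₁ _ hd => Finset.sum_eq_zero fun d₂ _ =>
        if_neg fun h' => hd (Subtype.ext h'.symm)
    · simp
  · intro B _ hB
    refine Finset.sum_eq_zero fun d₁ _ => Finset.sum_eq_zero fun d₂ _ => ?_
    split_ifs with h₁ h₂
    · exact absurd (Finset.mem_powerset.2 ((prod_dvd_iff hp hinj).1 ⟨d₂.1, by rw [h₁, h₂]⟩)) hB
    · rfl
    · rfl

open Classical in
theorem sum_onProducts (hp : ∀ i, Prime (p i)) (hinj : Function.Injective p)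
    {N : ℕ} (c : IdealsLE K N) (g : Finset (Fin r) → ℂ) :
    ∑ d : IdealsLE K N, (if d.1 ∣ c.1 then onProducts p g d.1 else 0) =
      ∑ B ∈ (labels p c.1).powerset, g B := by
  rw [← sum_mul_onProducts hp hinj (c := c) (g := g) (X := fun _ _ => 1) (by simp)]
  refine Finset.sum_congr rfl fun d _ => ?_
  split_ifs with h
  · obtain ⟨m, -, hm⟩ := exists_cofactor h
    rw [sum_mul_eq_ite hm, mul_one]
  · refine (Finset.sum_eq_zero fun d₂ _ => if_neg fun h' => h ⟨_, h'.symm⟩).symm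

open Classical in
theorem sum_mobius (hp : ∀ i, Prime (p i)) (hinj : Function.Injective p)
    {N : ℕ} (c : IdealsLE K N) :
    ∑ d : IdealsLE K N, (if d.1 ∣ c.1 then onProducts p (fun B => (-1) ^ B.card) d.1 else 0) =
      if labels p c.1 = ∅ then 1 else 0 := by
  rw [sum_onProducts hp hinj, sieve_identity (labels p c.1) (fun _ => 0) (by simp) le_rfl]
  simp

end PrimeFamily

/-! ### Weighted type I sums and type II sums with a separable kernel -/

theorem typeOneSum_le {N : ℕ} (A : IdealsLE K N → ℂ) (k : ℝ) (c : IdealsLE K N) :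
    typeOneSum A k c = if (Ideal.absNorm c.1 : ℝ) ≤ k then typeOneSum A N c else 0 := by
  have hc : (Ideal.absNorm c.1 : ℝ) ≤ N := by exact_mod_cast c.2.2
  simp only [typeOneSum, hc, if_true]

/-- Summation by parts turns a weight depending on the norm into a combination of cut-offs. -/
theorem hasMass_weighted_typeOne {N : ℕ} (χ : Ideal (𝓞 K) → ℂ) {A : IdealsLE K N → ℂ}
    (hA : LogBounded A) (ω : ℕ → ℝ) :
    HasMass (IsTwistedTypeOne χ) (|ω N| + ∑ k ∈ Finset.Ico 1 N, |ω (k + 1) - ω k|)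
      (fun c : IdealsLE K N => ω (Ideal.absNorm c.1) * (χ c.1 * typeOneSum A N c)) := by
  have h0 : HasMass (IsTwistedTypeOne χ) |ω N|
      (fun c : IdealsLE K N => (ω N : ℂ) * (χ c.1 * typeOneSum A N c)) := by
    have := (HasMass.of_mem (P := IsTwistedTypeOne χ)
      (f := fun c : IdealsLE K N => χ c.1 * typeOneSum A N c)
      ⟨A, N, hA, le_rfl, fun _ => rfl⟩).const_mul (ω N : ℂ)
    simpa using this
  have h1 : HasMass (IsTwistedTypeOne χ) (∑ k ∈ Finset.Ico 1 N, |ω (k + 1) - ω k|)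
      (fun c : IdealsLE K N => ∑ k ∈ Finset.Ico 1 N,
        (-(ω (k + 1) - ω k : ℝ) : ℂ) * (χ c.1 * typeOneSum A k c)) := by
    refine HasMass.of_fintype (ι := Finset.Ico 1 N) (fun k => (-(ω (k + 1) - ω k : ℝ) : ℂ))
      (fun k c => χ c.1 * typeOneSum A k c) (le_of_eq ?_) ?_ ?_
    · rw [← Finset.sum_coe_sort (Finset.Ico 1 N) (fun k => |ω (k + 1) - ω k|)]
      refine Finset.sum_congr rfl fun k _ => ?_
      rw [norm_neg, Complex.norm_real, Real.norm_eq_abs]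
    · rintro ⟨k, hk⟩
      exact ⟨A, k, hA, by exact_mod_cast (Finset.mem_Ico.1 hk).2.le, fun _ => rfl⟩
    · intro c
      rw [← Finset.sum_coe_sort (Finset.Ico 1 N) (fun k =>
        (-(ω (k + 1) - ω k : ℝ) : ℂ) * (χ c.1 * typeOneSum A k c))]
  convert h0.add h1 using 2 with c
  have h1c : 1 ≤ Ideal.absNorm c.1 := one_le_absNorm c.2.1
  have h2 : ∀ k ∈ Finset.Ico 1 N, (-(ω (k + 1) - ω k : ℝ) : ℂ) * (χ c.1 * typeOneSum A k c) =
      if Ideal.absNorm c.1 ≤ k then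
        (-(ω (k + 1) - ω k : ℝ) : ℂ) * (χ c.1 * typeOneSum A N c) else 0 := fun k _ => by
    rw [typeOneSum_le A k c]
    simp only [Nat.cast_le, mul_ite, mul_zero]
  rw [Finset.sum_congr rfl h2, ← Finset.sum_filter, show (Finset.Ico 1 N).filter (fun k => Ideal.absNorm c.1 ≤ k) =
    Finset.Ico (Ideal.absNorm c.1) N by
      ext k; simp only [Finset.mem_filter, Finset.mem_Ico]; omega, ← Finset.sum_mul,
    Finset.sum_neg_distrib, ← Complex.ofReal_sum, Finset.sum_Ico_sub _ c.2.2]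
  push_cast
  ring

open Classical in
theorem hasMass_typeTwo {N : ℕ} {L T : IdealsLE K N → ℂ} (hL : ∀ d, ‖L d‖ ≤ Real.log N)
    (hT : ∀ d, ‖T d‖ ≤ tau d.1) {M : ℝ} {F : IdealsLE K N × IdealsLE K N → ℂ}
    (hF : HasMass IsProductFun M F) :
    HasMass IsTypeTwo M (fun c : IdealsLE K N => ∑ d₁ : IdealsLE K N, ∑ d₂ : IdealsLE K N,
      if (N : ℝ) ^ (1 / 3 : ℝ) < Ideal.absNorm d₁.1 ∧ (N : ℝ) ^ (1 / 3 : ℝ) < Ideal.absNorm d₂.1 ∧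
        d₁.1 * d₂.1 = c.1 then L d₁ * T d₂ * F (d₁, d₂) else 0) := by
  refine hF.map (fun c d => if (N : ℝ) ^ (1 / 3 : ℝ) < Ideal.absNorm d.1.1 ∧
    (N : ℝ) ^ (1 / 3 : ℝ) < Ideal.absNorm d.2.1 ∧ d.1.1 * d.2.1 = c.1 then L d.1 * T d.2 else 0)
    Finset.univ ?_ fun c => ?_
  · rintro S ⟨u, v, hu, hv, hS⟩
    refine ⟨fun d => L d * u d, fun d => T d * v d, fun d => ?_, fun d => ?_, fun c => ?_⟩
    · rw [norm_mul]
      exact (mul_le_of_le_one_right (norm_nonneg _) (hu d)).trans (hL d)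
    · rw [norm_mul]
      exact (mul_le_of_le_one_right (norm_nonneg _) (hv d)).trans (hT d)
    · dsimp only
      rw [Fintype.sum_prod_type]
      refine Finset.sum_congr rfl fun d₁ _ => Finset.sum_congr rfl fun d₂ _ => ?_
      simp only [hS, ite_mul, zero_mul]
      split_ifs
      · ring
      · rfl
  · rw [Fintype.sum_prod_type]
    simp only [ite_mul, zero_mul]

theorem isTypeOne_of_isTwistedTypeOne_one {N : ℕ} {S : IdealsLE K N → ℂ}
    (h : IsTwistedTypeOne (fun _ => 1) S) : IsTypeOne S := by
  simpa only [IsTypeOne, IsTwistedTypeOne, one_mul] using h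

/-! ### A ramp function -/

/-- The piecewise linear function with slope `δ` that is `0` up to `Y` and reaches `1` at
`Y + δ⁻¹`. -/
def ramp (Y δ u : ℝ) : ℝ := max 0 (min 1 (δ * (u - Y)))

theorem ramp_nonneg (Y δ u : ℝ) : 0 ≤ ramp Y δ u := le_max_left _ _

theorem ramp_le_one (Y δ u : ℝ) : ramp Y δ u ≤ 1 := max_le zero_le_one (min_le_left _ _)

theorem ramp_mono {Y δ : ℝ} (hδ : 0 ≤ δ) : Monotone (ramp Y δ) := fun u v h => by
  unfold ramp
  gcongr

theorem ramp_eq_zero {Y δ u : ℝ} (hδ : 0 ≤ δ) (h : u ≤ Y) : ramp Y δ u = 0 :=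
  max_eq_left ((min_le_right _ _).trans (mul_nonpos_of_nonneg_of_nonpos hδ (by linarith)))

theorem ramp_eq_one {Y δ u : ℝ} (h : 1 ≤ δ * (u - Y)) : ramp Y δ u = 1 := by
  rw [ramp, min_eq_left h, max_eq_right zero_le_one]

theorem ramp_lipschitz {Y δ : ℝ} (hδ : 0 ≤ δ) (u v : ℝ) :
    |ramp Y δ u - ramp Y δ v| ≤ δ * |u - v| := by
  have h1 : |ramp Y δ u - ramp Y δ v| ≤ |min 1 (δ * (u - Y)) - min 1 (δ * (v - Y))| := by
    simpa [ramp] using abs_max_sub_max_le_max 0 (min 1 (δ * (u - Y))) 0 (min 1 (δ * (v - Y)))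
  have h2 : |min 1 (δ * (u - Y)) - min 1 (δ * (v - Y))| ≤ |δ * (u - Y) - δ * (v - Y)| := by
    simpa using abs_min_sub_min_le_max 1 (δ * (u - Y)) 1 (δ * (v - Y))
  refine (h1.trans h2).trans_eq ?_
  rw [← mul_sub, abs_mul, abs_of_nonneg hδ]
  congr 2
  ring

theorem sum_abs_sub_le_two {a b : ℕ → ℝ} (ha : ∀ k, 1 ≤ k → 0 ≤ a k ∧ a k ≤ 1)
    (hb : ∀ k, 1 ≤ k → 0 ≤ b k ∧ b k ≤ 1) (ha' : ∀ k, 1 ≤ k → a k ≤ a (k + 1))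
    (hb' : ∀ k, 1 ≤ k → b (k + 1) ≤ b k) {N : ℕ} (hN : 1 ≤ N) :
    ∑ k ∈ Finset.Ico 1 N, |a (k + 1) * b (k + 1) - a k * b k| ≤ 2 := by
  calc ∑ k ∈ Finset.Ico 1 N, |a (k + 1) * b (k + 1) - a k * b k|
      ≤ ∑ k ∈ Finset.Ico 1 N, ((a (k + 1) - a k) + -(b (k + 1) - b k)) := by
        refine Finset.sum_le_sum fun k hk => ?_
        have hk := (Finset.mem_Ico.1 hk).1
        have h1 := ha k hk
        have h2 := hb k hk
        have h3 := ha (k + 1) (by omega)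
        have h4 := hb (k + 1) (by omega)
        have h5 := ha' k hk
        have h6 := hb' k hk
        rw [abs_le]
        constructor <;> nlinarith
    _ ≤ 2 := by
        rw [Finset.sum_add_distrib, Finset.sum_neg_distrib, Finset.sum_Ico_sub _ hN,
          Finset.sum_Ico_sub _ hN]
        have := ha N hN
        have := hb N hN
        have := ha 1 le_rfl
        have := hb 1 le_rfl
        linarith

/-! ### Decomposition of a sifted set -/

set_option linter.unusedSectionVars false in
theorem onProducts_eq_zero {r : ℕ} {p : Fin r → Ideal (𝓞 K)} {g : Finset (Fin r) → ℂ}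
    {d : Ideal (𝓞 K)} (h : ∀ B, ∏ i ∈ B, p i = d → g B = 0) : onProducts p g d = 0 :=
  Finset.sum_eq_zero fun B _ => by
    split_ifs with hB
    exacts [h B hB, rfl]

open Classical in
theorem hasMass_sieve {N : ℕ} (hN : 3 ≤ N) {r : ℕ} {p : Fin r → Ideal (𝓞 K)}
    (hp : ∀ i, Prime (p i)) (hinj : Function.Injective p) {k : ℕ} (hk : r < 2 ^ k) {q : ℝ}
    (hq : ∀ i, (Ideal.absNorm (p i) : ℝ) ≤ q) {χ : Ideal (𝓞 K) → ℂ}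
    (hmul : ∀ c d, c ≠ ⊥ → d ≠ ⊥ → χ (c * d) = χ c * χ d) (hχ : ∀ c, ‖χ c‖ ≤ 1) {β : ℝ}
    (hβ : β ≤ 1) {Y : ℝ} (hY : (N : ℝ) ^ (2 / 3 : ℝ) * q ≤ Real.exp Y)
    (hcard : ((Finset.univ.filter fun c : IdealsLE K N =>
      Real.log (Ideal.absNorm c.1) ≤ Y + Real.log N / 6).card : ℝ) <
        N * Real.exp (-(1 / 10) * Real.sqrt (Real.log N))) :
    HasMass (fun S : IdealsLE K N → ℂ => IsTwistedTypeOne χ S ∨ IsTypeTwo S ∨ IsNegligible S)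
      (7 * (k + 1) + 4) (fun c => (if labels p c.1 = ∅ then 1 else 0) *
        (χ c.1 * ((Ideal.absNorm c.1 : ℝ) ^ (β - 1) : ℝ))) := by
  have hlog := one_le_log hN
  have hN0 : (0 : ℝ) < N := by positivity
  set U : ℝ := (N : ℝ) ^ (1 / 3 : ℝ) with hU
  have hU0 : 0 < U := by positivity
  have hU1 : 1 ≤ U := Real.one_le_rpow (by exact_mod_cast (by omega : 1 ≤ N)) (by norm_num)
  have hUU : U * U = (N : ℝ) ^ (2 / 3 : ℝ) := by
    rw [hU, ← Real.rpow_add hN0]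
    norm_num
  set δ : ℝ := 6 / Real.log N with hδ
  have hδ0 : 0 < δ := by positivity
  have hnorm : ∀ c : Ideal (𝓞 K), c ≠ ⊥ → (1 : ℝ) ≤ Ideal.absNorm c := fun c hc => by
    exact_mod_cast one_le_absNorm hc
  have hv : ∀ x : ℝ, 1 ≤ x → 0 ≤ x ^ (β - 1) ∧ x ^ (β - 1) ≤ 1 := fun x hx =>
    ⟨by positivity, Real.rpow_le_one_of_one_le_of_nonpos hx (by linarith)⟩
  set w : Finset (Fin r) → ℝ := fun B => Ideal.absNorm (∏ i ∈ B, p i) with hw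
  have hprod0 : ∀ B : Finset (Fin r), ∏ i ∈ B, p i ≠ ⊥ := fun B =>
    Finset.prod_ne_zero_iff.2 fun i _ => (hp i).ne_zero
  have hwmono : ∀ B C, B ⊆ C → w B ≤ w C := fun B C h => by
    simp only [hw, Nat.cast_le]
    exact absNorm_le_of_dvd (hprod0 C) (Finset.prod_dvd_prod_of_subset _ _ _ h)
  set g₁ : Finset (Fin r) → ℂ := fun B => if w B ≤ U then (-1) ^ B.card else 0 with hg₁
  set g₂ : Finset (Fin r) → ℂ := fun B => if ∃ i ∈ B, (∀ j ∈ B, i ≤ j) ∧ U < w B ∧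
    w (B.erase i) ≤ U then (-1) ^ B.card else 0 with hg₂
  have hg₁n : ∀ B, ‖g₁ B‖ ≤ 1 := fun B => by
    simp only [hg₁]
    split_ifs <;> simp
  have hg₂n : ∀ B, ‖g₂ B‖ ≤ 1 := fun B => by
    simp only [hg₂]
    split_ifs <;> simp
  -- the type I part
  have hA : LogBounded (fun d : IdealsLE K N => onProducts p g₁ d.1) := fun d =>
    (norm_onProducts_le hp hinj hg₁n d.1).trans hlog
  have hI := hasMass_weighted_typeOne χ hA
    (fun n => ramp Y δ (Real.log n) * (n : ℝ) ^ (β - 1))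
  have hmassI : |ramp Y δ (Real.log N) * (N : ℝ) ^ (β - 1)| +
      ∑ n ∈ Finset.Ico 1 N, |ramp Y δ (Real.log (n + 1 : ℕ)) * ((n + 1 : ℕ) : ℝ) ^ (β - 1) -
        ramp Y δ (Real.log n) * (n : ℝ) ^ (β - 1)| ≤ 3 := by
    have h1 : |ramp Y δ (Real.log N) * (N : ℝ) ^ (β - 1)| ≤ 1 := by
      have := hv N (by exact_mod_cast (by omega : 1 ≤ N))
      rw [abs_of_nonneg (mul_nonneg (ramp_nonneg _ _ _) this.1)]
      exact mul_le_one₀ (ramp_le_one _ _ _) this.1 this.2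
    have h2 := sum_abs_sub_le_two (a := fun n => ramp Y δ (Real.log n))
      (b := fun n => (n : ℝ) ^ (β - 1)) (fun n _ => ⟨ramp_nonneg _ _ _, ramp_le_one _ _ _⟩)
      (fun n hn => hv n (by exact_mod_cast hn))
      (fun n hn => ramp_mono hδ0.le (Real.log_le_log (by exact_mod_cast hn) (by simp)))
      (fun n hn => Real.rpow_le_rpow_of_nonpos (by exact_mod_cast hn) (by simp) (by linarith))
      (show 1 ≤ N by omega)
    linarith
  have hSI : ∀ c : IdealsLE K N, typeOneSum (fun d : IdealsLE K N => onProducts p g₁ d.1) N c =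
      ∑ B ∈ (labels p c.1).powerset, g₁ B := fun c => by
    rw [← sum_onProducts hp hinj, typeOneSum, if_pos (by exact_mod_cast c.2.2)]
    refine Finset.sum_congr rfl fun d _ => ?_
    by_cases hd : (Ideal.absNorm d.1 : ℝ) ≤ (N : ℝ) ^ (2 / 3 : ℝ)
    · simp [hd]
    · have : onProducts p g₁ d.1 = 0 := onProducts_eq_zero fun B hB => if_neg fun h => hd (by
        rw [← hB, ← hUU]
        exact h.trans (le_mul_of_one_le_left hU0.le hU1))
      simp [this]
  -- the type II part
  have hlab : ∀ c, minLabel p c < 2 ^ k := fun c => (minLabel_le c).trans_lt hk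
  have hF1 : HasMass IsProductFun (k + 1) (fun z : IdealsLE K N × IdealsLE K N =>
      if minLabel p z.1.1 ≤ minLabel p z.2.1 then (1 : ℂ) else 0) := by
    have := (hasMass_le k).comp_prod (fun d : IdealsLE K N => ⟨minLabel p d.1, hlab d.1⟩)
      (fun d : IdealsLE K N => ⟨minLabel p d.1, hlab d.1⟩)
    simpa only [Fin.mk_le_mk] using this
  have hF2 : HasMass IsProductFun 7 (fun z : IdealsLE K N × IdealsLE K N =>
      (ramp Y δ (Real.log (Ideal.absNorm z.1.1) + Real.log (Ideal.absNorm z.2.1)) : ℂ)) := by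
    refine (hasMass_lipschitz hδ0 (fun u => ?_) (ramp_lipschitz hδ0.le) (show 1 ≤ N by omega)
      (fun d : IdealsLE K N => Ideal.absNorm d.1) (fun d => ⟨one_le_absNorm d.2.1, d.2.2⟩)
      (fun d : IdealsLE K N => Real.log (Ideal.absNorm d.1))).mono ?_ fun _ h => h
    · rw [abs_of_nonneg (ramp_nonneg _ _ _)]
      exact ramp_le_one _ _ _
    · rw [hδ, div_mul_cancel₀ _ (by positivity)]
      norm_num
  have hF3 : HasMass IsProductFun 1 (fun z : IdealsLE K N × IdealsLE K N =>
      (χ z.1.1 * ((Ideal.absNorm z.1.1 : ℝ) ^ (β - 1) : ℝ)) *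
        (χ z.2.1 * ((Ideal.absNorm z.2.1 : ℝ) ^ (β - 1) : ℝ))) := by
    have hb : ∀ d : IdealsLE K N, ‖χ d.1 * ((Ideal.absNorm d.1 : ℝ) ^ (β - 1) : ℝ)‖ ≤ 1 := by
      intro d
      have := hv _ (hnorm d.1 d.2.1)
      rw [norm_mul, Complex.norm_real, Real.norm_of_nonneg this.1]
      exact mul_le_one₀ (hχ _) this.1 this.2
    exact HasMass.of_mem ⟨fun d : IdealsLE K N => χ d.1 * ((Ideal.absNorm d.1 : ℝ) ^ (β - 1) : ℝ),
      fun d : IdealsLE K N => χ d.1 * ((Ideal.absNorm d.1 : ℝ) ^ (β - 1) : ℝ), hb, hb,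
      fun _ => rfl⟩
  have hF := (hF1.mul hF2 (by positivity) fun _ _ => IsProductFun.mul).mul hF3 (by positivity)
    fun _ _ => IsProductFun.mul
  have hII := hasMass_typeTwo (L := fun d : IdealsLE K N => onProducts p g₂ d.1)
    (T := fun _ => 1) (fun d => (norm_onProducts_le hp hinj hg₂n d.1).trans hlog)
    (fun d => by simpa using one_le_tau d) hF
  have hSII : ∀ c : IdealsLE K N, (∑ d₁ : IdealsLE K N, ∑ d₂ : IdealsLE K N,
      if U < Ideal.absNorm d₁.1 ∧ U < Ideal.absNorm d₂.1 ∧ d₁.1 * d₂.1 = c.1 then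
        onProducts p g₂ d₁.1 * 1 * (((if minLabel p d₁.1 ≤ minLabel p d₂.1 then (1 : ℂ) else 0) *
          (ramp Y δ (Real.log (Ideal.absNorm d₁.1) + Real.log (Ideal.absNorm d₂.1)) : ℂ)) *
          ((χ d₁.1 * ((Ideal.absNorm d₁.1 : ℝ) ^ (β - 1) : ℝ)) *
            (χ d₂.1 * ((Ideal.absNorm d₂.1 : ℝ) ^ (β - 1) : ℝ)))) else 0) =
      (∑ B ∈ (labels p c.1).powerset, (if ∃ i ∈ B, (∀ j ∈ labels p c.1, i ≤ j) ∧ U < w B ∧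
        w (B.erase i) ≤ U then (-1) ^ B.card else 0)) *
        (ramp Y δ (Real.log (Ideal.absNorm c.1)) *
          (χ c.1 * ((Ideal.absNorm c.1 : ℝ) ^ (β - 1) : ℝ))) := by
    intro c
    rw [Finset.sum_mul]
    have hterm : ∀ d₁ d₂ : IdealsLE K N, d₁.1 * d₂.1 = c.1 →
        (ramp Y δ (Real.log (Ideal.absNorm d₁.1) + Real.log (Ideal.absNorm d₂.1)) : ℂ) *
          ((χ d₁.1 * ((Ideal.absNorm d₁.1 : ℝ) ^ (β - 1) : ℝ)) *
            (χ d₂.1 * ((Ideal.absNorm d₂.1 : ℝ) ^ (β - 1) : ℝ))) =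
        ramp Y δ (Real.log (Ideal.absNorm c.1)) *
          (χ c.1 * ((Ideal.absNorm c.1 : ℝ) ^ (β - 1) : ℝ)) := by
      intro d₁ d₂ h
      have h1 := hnorm d₁.1 d₁.2.1
      have h2 := hnorm d₂.1 d₂.2.1
      rw [← h, hmul _ _ d₁.2.1 d₂.2.1, map_mul, Nat.cast_mul, Real.log_mul (by positivity)
        (by positivity), Real.mul_rpow (by positivity) (by positivity)]
      push_cast
      ring
    rw [← sum_mul_onProducts hp hinj (g := g₂) (X := fun d₁ d₂ =>
      (if minLabel p d₁ ≤ minLabel p d₂ then (1 : ℂ) else 0) *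
        (ramp Y δ (Real.log (Ideal.absNorm c.1)) *
          (χ c.1 * ((Ideal.absNorm c.1 : ℝ) ^ (β - 1) : ℝ))))]
    · refine Finset.sum_congr rfl fun d₁ _ => Finset.sum_congr rfl fun d₂ _ => ?_
      by_cases h : d₁.1 * d₂.1 = c.1
      · by_cases h1 : U < Ideal.absNorm d₁.1
        · by_cases h2 : U < Ideal.absNorm d₂.1
          · simp only [h, h1, h2, and_self, if_true]
            rw [← hterm d₁ d₂ h]
            ring
          · simp only [h2, false_and, and_false, if_false, h, if_true]
            have : onProducts p g₂ d₁.1 = 0 ∨ ramp Y δ (Real.log (Ideal.absNorm c.1)) = 0 := by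
              by_contra! hcon
              refine hcon.1 (onProducts_eq_zero fun B hB => if_neg ?_)
              rintro ⟨i, hi, -, -, hle⟩
              refine hcon.2 (ramp_eq_zero hδ0.le ?_)
              have hc1 := hnorm c.1 c.2.1
              rw [Real.log_le_iff_le_exp (by positivity)]
              refine le_trans ?_ hY
              rw [← h, map_mul, ← hB, ← Finset.mul_prod_erase B p hi, map_mul]
              push_cast
              calc (Ideal.absNorm (p i) : ℝ) * w (B.erase i) * Ideal.absNorm d₂.1
                  ≤ q * U * U := by
                    have h3 : (0 : ℝ) ≤ q := (Nat.cast_nonneg _).trans (hq i)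
                    have h4 : 0 ≤ w (B.erase i) := Nat.cast_nonneg _
                    gcongr
                    exacts [hq i, not_lt.1 h2]
                _ = (N : ℝ) ^ (2 / 3 : ℝ) * q := by
                    rw [← hUU]
                    ring
            rcases this with h' | h' <;> simp [h']
        · have : onProducts p g₂ d₁.1 = 0 := onProducts_eq_zero fun B hB => if_neg (by
            rintro ⟨i, -, -, hlt, -⟩
            exact h1 (hB ▸ hlt))
          simp [this]
      · simp [h]
    · intro B hB m hm
      rw [← mul_assoc]
      congr 1
      by_cases hne : B.Nonempty
      · have hmem := B.min'_mem hne
        have hmin : ∀ j ∈ B, B.min' hne ≤ j := fun j hj => B.min'_le j hj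
        have huniq : ∀ {i}, i ∈ B → (∀ j ∈ B, i ≤ j) → i = B.min' hne := fun hi h =>
          le_antisymm (h _ hmem) (hmin _ hi)
        simp only [minLabel_prod_le_iff hp hinj hmem hmin, hm]
        by_cases h : ∀ j ∈ labels p c.1, B.min' hne ≤ j
        · rw [if_pos h, mul_one]
          refine if_congr ⟨?_, ?_⟩ rfl rfl
          · rintro ⟨i, hi, h1, h2⟩
            exact ⟨i, hi, (huniq hi h1) ▸ h, h2⟩
          · rintro ⟨i, hi, h1, h2⟩
            exact ⟨i, hi, fun j hj => h1 j (hB hj), h2⟩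
        · rw [if_neg h, mul_zero, if_neg]
          rintro ⟨i, hi, h1, -⟩
          exact h ((huniq hi fun j hj => h1 j (hB hj)) ▸ h1)
      · rw [Finset.not_nonempty_iff_eq_empty.1 hne]
        simp [hg₂]
  -- the negligible part
  have hneg : IsNegligible (fun c : IdealsLE K N => (if labels p c.1 = ∅ then (1 : ℂ) else 0) *
      (χ c.1 * ((Ideal.absNorm c.1 : ℝ) ^ (β - 1) : ℝ)) *
        (1 - ramp Y δ (Real.log (Ideal.absNorm c.1)) : ℝ)) := by
    have hb : ∀ c : IdealsLE K N, ‖(if labels p c.1 = ∅ then (1 : ℂ) else 0) *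
        (χ c.1 * ((Ideal.absNorm c.1 : ℝ) ^ (β - 1) : ℝ)) *
          (1 - ramp Y δ (Real.log (Ideal.absNorm c.1)) : ℝ)‖ ≤
        if Real.log (Ideal.absNorm c.1) ≤ Y + Real.log N / 6 then 1 else 0 := by
      intro c
      have h1 := hv _ (hnorm c.1 c.2.1)
      have h2 := ramp_nonneg Y δ (Real.log (Ideal.absNorm c.1))
      have h3 := ramp_le_one Y δ (Real.log (Ideal.absNorm c.1))
      by_cases h : Real.log (Ideal.absNorm c.1) ≤ Y + Real.log N / 6
      · rw [if_pos h, norm_mul, norm_mul, norm_mul, Complex.norm_real, Complex.norm_real,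
          Real.norm_of_nonneg h1.1, Real.norm_of_nonneg (by linarith)]
        refine mul_le_one₀ (mul_le_one₀ (norm_ite_one_zero_le _) (by positivity) ?_)
          (by linarith) (by linarith)
        exact mul_le_one₀ (hχ _) h1.1 h1.2
      · rw [if_neg h, ramp_eq_one]
        · simp
        · rw [hδ, div_mul_eq_mul_div, le_div_iff₀ (by positivity)]
          linarith
    refine ⟨fun c => (hb c).trans ?_, lt_of_le_of_lt (Finset.sum_le_sum fun c _ => hb c) ?_⟩
    · split_ifs <;> linarith
    · simpa using hcard
  have htotal := ((hI.mono hmassI fun S hS => Or.inl hS).add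
    (hII.mono le_rfl fun S hS => Or.inr (Or.inl hS))).add
    (HasMass.of_mem (P := fun S : IdealsLE K N → ℂ => IsTwistedTypeOne χ S ∨ IsTypeTwo S ∨
      IsNegligible S) (Or.inr (Or.inr hneg)))
  convert htotal.mono (M' := 7 * (k + 1) + 4) (by linarith) fun _ h => h using 2 with c
  rw [hSII, hSI, sieve_identity (labels p c.1) w hwmono (D := U) (by simpa [hw] using hU1)]
  push_cast
  ring

/-! ### The von Mangoldt function -/

theorem mangoldt_pow {p : Ideal (𝓞 K)} (hp : Prime p) {k : ℕ} (hk : 0 < k) :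
    mangoldt (p ^ k) = Real.log (Ideal.absNorm p) := by
  have h : IsPrimePow (p ^ k) := ⟨p, k, hp, hk, rfl⟩
  rw [mangoldt, dif_pos h]
  obtain ⟨m, hq, hm, heq⟩ := h.choose_spec
  have hdvd : h.choose ∣ p := hq.dvd_of_dvd_pow (heq ▸ dvd_pow_self _ hm.ne')
  rw [associated_iff_eq.1 (hq.associated_of_dvd hp hdvd)]

theorem mangoldt_nonneg (c : Ideal (𝓞 K)) : 0 ≤ mangoldt c := by
  rw [mangoldt]
  split_ifs
  · exact Real.log_natCast_nonneg _
  · rfl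

theorem mangoldt_dvd_sub {p a b : Ideal (𝓞 K)} (hp : Prime p) {v : ℕ} (ha : ¬ p ∣ a)
    [Decidable (b ∣ p ^ (v + 1) * a)] [Decidable (b ∣ p ^ v * a)] [Decidable (b = p ^ (v + 1))] :
    (if b ∣ p ^ (v + 1) * a then mangoldt b else 0) =
      (if b ∣ p ^ v * a then mangoldt b else 0) +
        if b = p ^ (v + 1) then Real.log (Ideal.absNorm p) else 0 := by
  have hpow : ∀ k w : ℕ, p ^ k ∣ p ^ w * a ↔ k ≤ w := fun k w => by
    refine ⟨fun h => ?_, fun h => (pow_dvd_pow p h).mul_right a⟩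
    exact (pow_dvd_pow_iff hp.ne_zero hp.not_isUnit).1 (hp.pow_dvd_of_dvd_mul_right k ha h)
  by_cases hb : IsPrimePow b
  · obtain ⟨q, k, hq, hk, rfl⟩ := hb
    by_cases hqp : q = p
    · subst hqp
      have hinj : q ^ k = q ^ (v + 1) ↔ k = v + 1 :=
        ⟨fun h => le_antisymm ((pow_dvd_pow_iff hq.ne_zero hq.not_isUnit).1 h.dvd)
          ((pow_dvd_pow_iff hq.ne_zero hq.not_isUnit).1 h.symm.dvd), fun h => by rw [h]⟩
      simp only [hpow, mangoldt_pow hq hk, hinj]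
      split_ifs <;> first | omega | simp
    · have hne : q ^ k ≠ p ^ (v + 1) := fun h => hqp (associated_iff_eq.1
        (hq.associated_of_dvd hp (hq.dvd_of_dvd_pow (h ▸ dvd_pow_self _ hk.ne'))))
      have hnd : ∀ w, ¬ q ∣ p ^ w := fun w h =>
        hqp (associated_iff_eq.1 (hq.associated_of_dvd hp (hq.dvd_of_dvd_pow h)))
      have hiff : ∀ w, q ^ k ∣ p ^ w * a ↔ q ^ k ∣ a := fun w =>
        ⟨hq.pow_dvd_of_dvd_mul_left k (hnd w), fun h => h.mul_left _⟩
      rw [if_neg hne, add_zero]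
      exact if_congr ((hiff _).trans (hiff _).symm) rfl rfl
  · have h0 : mangoldt b = 0 := dif_neg hb
    have hne : b ≠ p ^ (v + 1) := fun h => hb (h ▸ ⟨p, v + 1, hp, by omega, rfl⟩)
    simp [h0, hne]

open Classical in
theorem sum_mangoldt_aux {N : ℕ} (c : Ideal (𝓞 K)) (hc : c ≠ ⊥) (hcN : Ideal.absNorm c ≤ N) :
    ∑ b : IdealsLE K N, (if b.1 ∣ c then mangoldt b.1 else 0) = Real.log (Ideal.absNorm c) := by
  induction c using UniqueFactorizationMonoid.induction_on_prime with
  | h₁ => exact absurd rfl hc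
  | h₂ c h =>
    rw [Ideal.isUnit_iff.1 h, Ideal.absNorm_top, Nat.cast_one, Real.log_one]
    refine Finset.sum_eq_zero fun b _ => ?_
    split_ifs with hb
    · refine dif_neg fun hpp => ?_
      rw [← Ideal.one_eq_top] at hb
      exact hpp.not_isUnit (isUnit_of_dvd_one hb)
    · rfl
  | h₃ c p hc0 hp ih =>
    have hle := absNorm_le_of_dvd hc (dvd_mul_left c p)
    obtain ⟨a, ha, hpa⟩ :=
      (FiniteMultiplicity.of_prime_left hp hc0).exists_eq_pow_mul_and_not_dvd
    set v := multiplicity p c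
    have hdvd : p ^ (v + 1) ∣ p * c := ⟨a, by rw [ha, pow_succ', mul_assoc]⟩
    have hterm : ∀ b : IdealsLE K N, (if b.1 ∣ p * c then mangoldt b.1 else 0) =
        (if b.1 ∣ c then mangoldt b.1 else 0) +
          if b = IdealsLE.divisor ⟨p * c, hc, hcN⟩ hdvd
            then Real.log (Ideal.absNorm p) else 0 := by
      intro b
      rw [if_congr (Subtype.ext_iff (a1 := b)) rfl rfl]
      have h : p * c = p ^ (v + 1) * a := by rw [ha, pow_succ', mul_assoc]
      rw [if_congr (iff_of_eq (congrArg (b.1 ∣ ·) h)) rfl rfl,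
        if_congr (iff_of_eq (congrArg (b.1 ∣ ·) ha)) rfl rfl]
      exact mangoldt_dvd_sub hp hpa
    rw [Finset.sum_congr rfl fun b _ => hterm b, Finset.sum_add_distrib, ih hc0 (hle.trans hcN),
      Finset.sum_ite_eq' Finset.univ, if_pos (Finset.mem_univ _), map_mul, Nat.cast_mul,
      Real.log_mul, add_comm]
    · exact_mod_cast Nat.one_le_iff_ne_zero.1 (one_le_absNorm hp.ne_zero)
    · exact_mod_cast Nat.one_le_iff_ne_zero.1 (one_le_absNorm hc0)

open Classical in
theorem sum_mangoldt {N : ℕ} (c : IdealsLE K N) :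
    ∑ b : IdealsLE K N, (if b.1 ∣ c.1 then (mangoldt b.1 : ℂ) else 0) =
      (Real.log (Ideal.absNorm c.1) : ℂ) := by
  rw [← sum_mangoldt_aux (N := N) c.1 c.2.1 c.2.2]
  rw [Complex.ofReal_sum]
  refine Finset.sum_congr rfl fun b _ => ?_
  split_ifs <;> simp

theorem mangoldt_le_log {N : ℕ} (c : IdealsLE K N) :
    mangoldt c.1 ≤ Real.log (Ideal.absNorm c.1) := by
  classical
  rw [← sum_mangoldt_aux (N := N) c.1 c.2.1 c.2.2]
  refine le_trans (by simp) (Finset.single_le_sum (fun b _ => ?_) (Finset.mem_univ c))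
  split_ifs
  exacts [mangoldt_nonneg _, le_rfl]

theorem log_absNorm_le {N : ℕ} (c : IdealsLE K N) :
    Real.log (Ideal.absNorm c.1) ≤ Real.log N :=
  Real.log_le_log (by exact_mod_cast one_le_absNorm c.2.1) (by exact_mod_cast c.2.2)

theorem log_absNorm_nonneg (c : Ideal (𝓞 K)) : 0 ≤ Real.log (Ideal.absNorm c) :=
  Real.log_natCast_nonneg _

/-! ### Vaughan's identity -/

set_option linter.unusedSectionVars false in
theorem exists_prime_family (s : Finset (Ideal (𝓞 K))) :
    ∃ p : Fin s.card → Ideal (𝓞 K), Function.Injective p ∧ ∀ c, c ∈ s ↔ ∃ i, p i = c := by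
  refine ⟨fun i => (s.equivFin.symm i).1, fun i j h => s.equivFin.symm.injective (Subtype.ext h),
    fun c => ⟨fun hc => ⟨s.equivFin ⟨c, hc⟩, by simp⟩, ?_⟩⟩
  rintro ⟨i, rfl⟩
  exact (s.equivFin.symm i).2

open Classical in
/-- The Möbius function on the ideals of norm at most `N`. -/
theorem exists_mobius (N : ℕ) : ∃ μ : IdealsLE K N → ℂ, (∀ d, ‖μ d‖ ≤ 1) ∧
    ∀ c : IdealsLE K N, ∑ d : IdealsLE K N, (if d.1 ∣ c.1 then μ d else 0) =
      if c.1 = 1 then 1 else 0 := by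
  let s : Finset (Ideal (𝓞 K)) :=
    (Finset.univ.filter fun d : IdealsLE K N => Prime d.1).image Subtype.val
  obtain ⟨p, hinj, hs⟩ := exists_prime_family s
  have hp : ∀ i, Prime (p i) := fun i => by
    obtain ⟨d, hd, h⟩ := Finset.mem_image.1 ((hs _).2 ⟨i, rfl⟩)
    exact h ▸ (Finset.mem_filter.1 hd).2
  refine ⟨fun d => onProducts p (fun B => (-1) ^ B.card) d.1,
    fun d => norm_onProducts_le hp hinj (by simp) d.1, fun c => ?_⟩
  rw [sum_mobius hp hinj]
  refine if_congr ⟨fun h => ?_, fun h => ?_⟩ rfl rfl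
  · by_contra hc
    obtain ⟨q, hq, hqc⟩ := WfDvdMonoid.exists_irreducible_factor
      (fun hu => hc (by rw [Ideal.one_eq_top]; exact Ideal.isUnit_iff.1 hu)) c.2.1
    obtain ⟨i, hi⟩ := (hs q).1 (Finset.mem_image.2 ⟨c.divisor hqc, by
      simpa [IdealsLE.divisor] using hq.prime, rfl⟩)
    have : i ∈ labels p c.1 := mem_labels.2 (hi ▸ hqc)
    rw [h] at this
    simp at this
  · rw [h]
    refine Finset.eq_empty_of_forall_notMem fun i hi => ?_
    exact (hp i).not_isUnit (isUnit_of_dvd_one (mem_labels.1 hi))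

open Classical in
theorem sum_mul_dvd {N : ℕ} (f : IdealsLE K N → ℂ) {b c m : IdealsLE K N} (h : b.1 * m.1 = c.1) :
    ∑ a : IdealsLE K N, (if b.1 * a.1 ∣ c.1 then f a else 0) =
      ∑ a : IdealsLE K N, (if a.1 ∣ m.1 then f a else 0) := by
  refine Finset.sum_congr rfl fun a _ => if_congr ?_ rfl rfl
  rw [← h]
  exact mul_dvd_mul_iff_left (show b.1 ≠ 0 from b.2.1)

open Classical in
theorem sum_mul_dvd_of_not_dvd {N : ℕ} (f : IdealsLE K N → ℂ) {b c : IdealsLE K N}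
    (h : ¬ b.1 ∣ c.1) : ∑ a : IdealsLE K N, (if b.1 * a.1 ∣ c.1 then f a else 0) = 0 :=
  Finset.sum_eq_zero fun _ _ => if_neg fun h' => h ((dvd_mul_right _ _).trans h')

open Classical in
theorem sum_mul_eq_of_dvd_iff {N : ℕ} (b a c : IdealsLE K N) (z : ℂ) :
    ∑ d : IdealsLE K N, (if d.1 ∣ c.1 then if b.1 * a.1 = d.1 then z else 0 else 0) =
      if b.1 * a.1 ∣ c.1 then z else 0 := by
  split_ifs with h
  · rw [Finset.sum_eq_single (c.divisor h)]
    · simp [IdealsLE.divisor, h]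
    · intro d _ hd
      have : b.1 * a.1 ≠ d.1 := fun h' => hd (Subtype.ext h'.symm)
      simp [this]
    · simp
  · refine Finset.sum_eq_zero fun d _ => ?_
    split_ifs with h₁ h₂
    · exact absurd (h₂ ▸ h₁) h
    · rfl
    · rfl

open Classical in
theorem hasMass_mangoldt {N : ℕ} (hN : 3 ≤ N)
    (hcard : Real.log N * ((Finset.univ.filter fun c : IdealsLE K N =>
      (Ideal.absNorm c.1 : ℝ) ≤ (N : ℝ) ^ (1 / 3 : ℝ)).card : ℝ) <
        N * Real.exp (-(1 / 10) * Real.sqrt (Real.log N))) :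
    HasMass (fun S : IdealsLE K N → ℂ => IsTypeOne S ∨ IsTypeTwo S ∨ IsNegligible S)
      (6 * Real.log N) (fun c => (mangoldt c.1 : ℂ)) := by
  have hlog := one_le_log hN
  have hN0 : (0 : ℝ) < N := by positivity
  set U : ℝ := (N : ℝ) ^ (1 / 3 : ℝ) with hU
  have hU0 : 0 < U := by positivity
  have hU1 : 1 ≤ U := Real.one_le_rpow (by exact_mod_cast (by omega : 1 ≤ N)) (by norm_num)
  have hUU : (N : ℝ) ^ (2 / 3 : ℝ) = U * U := by
    rw [hU, ← Real.rpow_add hN0]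
    norm_num
  obtain ⟨μ, hμ, hμsum⟩ := exists_mobius (K := K) N
  let S : (IdealsLE K N → Prop) := fun d => (Ideal.absNorm d.1 : ℝ) ≤ U
  -- the full double sum over one of the variables
  have hsumμ : ∀ b c : IdealsLE K N, ∑ a : IdealsLE K N, (if b.1 * a.1 ∣ c.1 then μ a else 0) =
      if b = c then 1 else 0 := by
    intro b c
    by_cases h : b.1 ∣ c.1
    · obtain ⟨m, hm, -⟩ := exists_cofactor h
      rw [sum_mul_dvd μ hm, hμsum]
      refine if_congr ?_ rfl rfl
      rw [Subtype.ext_iff, ← hm, left_eq_mul₀ (show b.1 ≠ 0 from b.2.1)]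
    · rw [sum_mul_dvd_of_not_dvd μ h, if_neg]
      rintro rfl
      exact h dvd_rfl
  have hsumΛ : ∀ a c : IdealsLE K N,
      ∑ b : IdealsLE K N, (if b.1 * a.1 ∣ c.1 then (mangoldt b.1 : ℂ) else 0) =
      if a.1 ∣ c.1 then
        (Real.log (Ideal.absNorm c.1) : ℂ) - Real.log (Ideal.absNorm a.1) else 0 := by
    intro a c
    simp only [mul_comm _ a.1]
    split_ifs with h
    · obtain ⟨m, hm, -⟩ := exists_cofactor h
      rw [sum_mul_dvd _ hm, sum_mangoldt, ← hm, map_mul, Nat.cast_mul, Real.log_mul]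
      · push_cast
        ring
      · exact_mod_cast Nat.one_le_iff_ne_zero.1 (one_le_absNorm a.2.1)
      · exact_mod_cast Nat.one_le_iff_ne_zero.1 (one_le_absNorm m.2.1)
    · exact sum_mul_dvd_of_not_dvd _ h
  -- the four parts
  let P : (IdealsLE K N → ℂ) → Prop := fun S => IsTypeOne S ∨ IsTypeTwo S ∨ IsNegligible S
  let A₁ : IdealsLE K N → ℂ := fun d => if S d then μ d else 0
  let A₂ : IdealsLE K N → ℂ := fun d => if S d then μ d * Real.log (Ideal.absNorm d.1) else 0
  let A₃ : IdealsLE K N → ℂ := fun d => ∑ b : IdealsLE K N, ∑ a : IdealsLE K N,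
    if b.1 * a.1 = d.1 then if S b ∧ S a then mangoldt b.1 * μ a else 0 else 0
  have hA₁ : LogBounded A₁ := fun d => by
    simp only [A₁]
    split_ifs
    · exact (hμ d).trans hlog
    · simpa using by linarith
  have hA₂ : LogBounded A₂ := fun d => by
    simp only [A₂]
    split_ifs
    · rw [norm_mul, Complex.norm_real, Real.norm_of_nonneg (log_absNorm_nonneg _)]
      exact (mul_le_of_le_one_left (log_absNorm_nonneg _) (hμ d)).trans (log_absNorm_le d)
    · simpa using by linarith
  have hA₃ : LogBounded A₃ := fun d => by
    refine le_trans ?_ ((sum_mangoldt_aux (N := N) d.1 d.2.1 d.2.2).le.trans (log_absNorm_le d))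
    refine (norm_sum_le _ _).trans (Finset.sum_le_sum fun b _ => ?_)
    split_ifs with h
    · obtain ⟨m, -, hm⟩ := exists_cofactor h
      rw [sum_mul_eq_ite hm (fun a => if S b ∧ S a then (mangoldt b.1 : ℂ) * μ a else 0)]
      split_ifs
      · rw [norm_mul, Complex.norm_real, Real.norm_of_nonneg (mangoldt_nonneg _)]
        exact mul_le_of_le_one_right (mangoldt_nonneg _) (hμ m)
      · simpa using mangoldt_nonneg _
    · rw [Finset.sum_eq_zero fun a _ => if_neg fun h' => h ⟨_, h'.symm⟩, norm_zero]
  have hsmall : ∀ A : IdealsLE K N → ℂ, (∀ d, ¬ (Ideal.absNorm d.1 : ℝ) ≤ U * U → A d = 0) →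
      ∀ c, typeOneSum A N c = ∑ d, if d.1 ∣ c.1 then A d else 0 := by
    intro A hA c
    rw [typeOneSum, if_pos (by exact_mod_cast c.2.2)]
    refine Finset.sum_congr rfl fun d _ => ?_
    rw [hUU]
    by_cases hd : (Ideal.absNorm d.1 : ℝ) ≤ U * U
    · simp [hd]
    · simp [hA d hd]
  have hSU : ∀ d : IdealsLE K N, S d → (Ideal.absNorm d.1 : ℝ) ≤ U * U := fun d hd =>
    le_trans hd (le_mul_of_one_le_left hU0.le hU1)
  have hone : ∀ {A : IdealsLE K N → ℂ}, LogBounded A → HasMass P 1 (typeOneSum A N) :=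
    fun {A} hA => HasMass.of_mem (Or.inl ⟨A, N, hA, le_rfl, fun _ => rfl⟩)
  have h₁ : HasMass P (2 * Real.log N)
      (fun c => Real.log (Ideal.absNorm c.1) * typeOneSum A₁ N c) := by
    have := hasMass_weighted_typeOne (fun _ => 1) hA₁ (fun n => Real.log n)
    simp only [one_mul] at this
    refine this.mono ?_ fun _ hS => Or.inl (isTypeOne_of_isTwistedTypeOne_one hS)
    have hmono : ∀ k ∈ Finset.Ico 1 N, |Real.log (k + 1 : ℕ) - Real.log k| =
        Real.log (k + 1 : ℕ) - Real.log k := fun k hk => abs_of_nonneg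
      (sub_nonneg.2 (Real.log_le_log (by exact_mod_cast (Finset.mem_Ico.1 hk).1)
        (show (k : ℝ) ≤ (k + 1 : ℕ) by simp)))
    rw [abs_of_nonneg (by linarith), Finset.sum_congr rfl hmono,
      Finset.sum_Ico_sub (fun n : ℕ => Real.log n) (by omega), Nat.cast_one, Real.log_one]
    linarith
  let T : IdealsLE K N → ℂ := fun m => ∑ a : IdealsLE K N,
    if a.1 ∣ m.1 then if ¬ S a then μ a else 0 else 0
  have hT : ∀ m, ‖T m‖ ≤ tau m.1 := fun m => by
    rw [tau_eq, Finset.card_filter, Nat.cast_sum]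
    refine (norm_sum_le _ _).trans (Finset.sum_le_sum fun a _ => ?_)
    split_ifs
    · simp
    · simpa using hμ a
    · simp
  let II : IdealsLE K N → ℂ := fun c => ∑ d₁ : IdealsLE K N, ∑ d₂ : IdealsLE K N,
    if U < Ideal.absNorm d₁.1 ∧ U < Ideal.absNorm d₂.1 ∧ d₁.1 * d₂.1 = c.1 then
      (mangoldt d₁.1 : ℂ) * T d₂ else 0
  have hII : HasMass P 1 II := by
    refine HasMass.of_mem (Or.inr (Or.inl ⟨fun d => mangoldt d.1, T, fun d => ?_, hT,
      fun _ => rfl⟩))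
    rw [Complex.norm_real, Real.norm_of_nonneg (mangoldt_nonneg _)]
    exact (mangoldt_le_log d).trans (log_absNorm_le d)
  have hneg : IsNegligible (fun c : IdealsLE K N => if S c then (mangoldt c.1 : ℂ) else 0) := by
    have hb : ∀ c : IdealsLE K N, ‖(if S c then (mangoldt c.1 : ℂ) else 0)‖ ≤
        if S c then Real.log N else 0 := fun c => by
      split_ifs
      · rw [Complex.norm_real, Real.norm_of_nonneg (mangoldt_nonneg _)]
        exact (mangoldt_le_log c).trans (log_absNorm_le c)
      · simp
    refine ⟨fun c => (hb c).trans ?_, lt_of_le_of_lt (Finset.sum_le_sum fun c _ => hb c) ?_⟩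
    · split_ifs <;> linarith
    · rw [← Finset.sum_filter, Finset.sum_const, nsmul_eq_mul, mul_comm]
      exact hcard
  have htotal := ((((HasMass.of_mem (P := P) (Or.inr (Or.inr hneg))).add h₁).add
    ((hone hA₂).const_mul (-1))).add ((hone hA₃).const_mul (-1))).add hII
  refine HasMass.mono (P := P) (M := 1 + 2 * Real.log N + ‖(-1 : ℂ)‖ * 1 + ‖(-1 : ℂ)‖ * 1 + 1)
    ?_ (by rw [norm_neg, norm_one]; linarith) fun _ h => h
  convert htotal using 2 with c
  -- the identity at `c`
  have e0 : (mangoldt c.1 : ℂ) = ∑ b : IdealsLE K N, ∑ a : IdealsLE K N,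
      if b.1 * a.1 ∣ c.1 then (mangoldt b.1 : ℂ) * μ a else 0 := by
    simp only [← mul_ite_zero, ← Finset.mul_sum, hsumμ]
    simp
  have e1 : (if S c then (mangoldt c.1 : ℂ) else 0) = ∑ b : IdealsLE K N, ∑ a : IdealsLE K N,
      if b.1 * a.1 ∣ c.1 then (if S b then (mangoldt b.1 : ℂ) else 0) * μ a else 0 := by
    simp only [← mul_ite_zero, ← Finset.mul_sum, hsumμ]
    simp
  have e2 : Real.log (Ideal.absNorm c.1) * typeOneSum A₁ N c + -1 * typeOneSum A₂ N c =
      ∑ b : IdealsLE K N, ∑ a : IdealsLE K N,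
      if b.1 * a.1 ∣ c.1 then (mangoldt b.1 : ℂ) * (if S a then μ a else 0) else 0 := by
    rw [Finset.sum_comm, hsmall A₁ (fun d hd => if_neg fun h => hd (hSU d h)),
      hsmall A₂ (fun d hd => if_neg fun h => hd (hSU d h)), Finset.mul_sum, Finset.mul_sum,
      ← Finset.sum_add_distrib]
    refine Finset.sum_congr rfl fun a _ => ?_
    simp only [← ite_zero_mul, ← Finset.sum_mul, hsumΛ]
    simp only [A₁, A₂]
    split_ifs <;> ring
  have e3 : typeOneSum A₃ N c = ∑ b : IdealsLE K N, ∑ a : IdealsLE K N,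
      if b.1 * a.1 ∣ c.1 then if S b ∧ S a then (mangoldt b.1 : ℂ) * μ a else 0 else 0 := by
    rw [hsmall A₃]
    · simp only [← sum_mul_eq_of_dvd_iff]
      conv_rhs => enter [2, b]; rw [Finset.sum_comm]
      rw [Finset.sum_comm]
      refine Finset.sum_congr rfl fun d _ => ?_
      simp only [A₃]
      split_ifs
      · rfl
      · simp
    · intro d hd
      refine Finset.sum_eq_zero fun b _ => Finset.sum_eq_zero fun a _ => ?_
      split_ifs with h h'
      · refine absurd ?_ hd
        rw [← h, map_mul, Nat.cast_mul]
        exact mul_le_mul h'.1 h'.2 (Nat.cast_nonneg _) hU0.le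
      · rfl
      · rfl
  have e4 : II c = ∑ b : IdealsLE K N, ∑ a : IdealsLE K N,
      if b.1 * a.1 ∣ c.1 then if ¬ S b ∧ ¬ S a then (mangoldt b.1 : ℂ) * μ a else 0 else 0 := by
    refine Finset.sum_congr rfl fun b _ => ?_
    by_cases hb : b.1 ∣ c.1
    · obtain ⟨m, hm, hm'⟩ := exists_cofactor hb
      rw [sum_mul_dvd _ hm]
      have : ∀ d₂ : IdealsLE K N, (if U < Ideal.absNorm b.1 ∧ U < Ideal.absNorm d₂.1 ∧
          b.1 * d₂.1 = c.1 then (mangoldt b.1 : ℂ) * T d₂ else 0) =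
          if b.1 * d₂.1 = c.1 then if ¬ S b ∧ ¬ S d₂ then (mangoldt b.1 : ℂ) * T d₂ else 0
            else 0 := fun d₂ => by
        simp only [S, not_le]
        split_ifs <;> first | rfl | (exfalso; tauto)
      rw [Finset.sum_congr rfl fun d₂ _ => this d₂, sum_mul_eq_ite hm'
        (fun d₂ => if ¬ S b ∧ ¬ S d₂ then (mangoldt b.1 : ℂ) * T d₂ else 0)]
      by_cases hSb : S b
      · simp [hSb]
      by_cases hSm : S m
      · simp only [hSb, hSm, not_true, and_false, if_false]
        refine (Finset.sum_eq_zero fun a _ => ?_).symm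
        by_cases ha : a.1 ∣ m.1
        · have : S a := le_trans (by exact_mod_cast absNorm_le_of_dvd m.2.1 ha) hSm
          simp [this]
        · simp [ha]
      · simp only [hSb, hSm, not_false_eq_true, true_and, and_self, if_true, T, Finset.mul_sum]
        refine Finset.sum_congr rfl fun a _ => ?_
        split_ifs <;> simp
    · rw [sum_mul_dvd_of_not_dvd _ hb]
      exact Finset.sum_eq_zero fun d₂ _ => if_neg fun h => hb ⟨_, h.2.2.symm⟩
  rw [add_assoc (if S c then (mangoldt c.1 : ℂ) else 0), e1, e0, e2, e3, e4, neg_one_mul,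
    ← Finset.sum_neg_distrib]
  simp only [← Finset.sum_neg_distrib, ← Finset.sum_add_distrib]
  refine Finset.sum_congr rfl fun b _ => Finset.sum_congr rfl fun a _ => ?_
  by_cases h : b.1 * a.1 ∣ c.1 <;> by_cases hb : S b <;> by_cases ha : S a <;> simp [h, hb, ha]

/-! ### Counting ideals -/

variable (K) in
theorem exists_card_le : ∃ C : ℝ, 0 < C ∧ ∀ x : ℝ, 1 ≤ x → ∀ s : Finset (Ideal (𝓞 K)),
    (∀ c ∈ s, (Ideal.absNorm c : ℝ) ≤ x) → (s.card : ℝ) ≤ C * x := by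
  set f : ℝ → ℝ := fun x => (Nat.card {I : Ideal (𝓞 K) // (Ideal.absNorm I : ℝ) ≤ x} : ℝ) with hf
  have hfin : ∀ x : ℝ, 0 ≤ x → {I : Ideal (𝓞 K) | (Ideal.absNorm I : ℝ) ≤ x}.Finite := by
    intro x hx
    refine (Ideal.finite_setOfPred_absNorm_le (S := 𝓞 K) ⌊x⌋₊).subset fun I hI => ?_
    exact (Nat.le_floor_iff hx).2 hI
  have hcard : ∀ x : ℝ, 0 ≤ x → ∀ s : Finset (Ideal (𝓞 K)),
      (∀ c ∈ s, (Ideal.absNorm c : ℝ) ≤ x) → (s.card : ℝ) ≤ f x := by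
    intro x hx s hs
    have := Set.ncard_le_ncard (s := (s : Set (Ideal (𝓞 K))))
      (t := {I : Ideal (𝓞 K) | (Ideal.absNorm I : ℝ) ≤ x}) (fun c hc => hs c hc) (hfin x hx)
    rw [Set.ncard_coe_finset] at this
    exact Nat.cast_le.2 this
  have hmono : ∀ x y : ℝ, 0 ≤ y → x ≤ y → f x ≤ f y := by
    intro x y hy hxy
    have := Set.ncard_le_ncard (s := {I : Ideal (𝓞 K) | (Ideal.absNorm I : ℝ) ≤ x})
      (t := {I : Ideal (𝓞 K) | (Ideal.absNorm I : ℝ) ≤ y}) (fun c hc => le_trans hc hxy) (hfin y hy)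
    exact Nat.cast_le.2 this
  obtain ⟨L, hL⟩ : ∃ L, Filter.Tendsto (fun x : ℝ => f x / x) Filter.atTop (nhds L) :=
    ⟨_, NumberField.Ideal.tendsto_norm_le_div_atTop K⟩
  obtain ⟨x₀, hx₀⟩ := Filter.eventually_atTop.1
    (hL.eventually (gt_mem_nhds (show L < |L| + 1 by linarith [le_abs_self L])))
  set y := max x₀ 1
  have hy1 : 1 ≤ y := le_max_right _ _
  have hfy : 0 ≤ f y := Nat.cast_nonneg _
  refine ⟨|L| + 1 + f y, by positivity, fun x hx s hs => (hcard x (by linarith) s hs).trans ?_⟩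
  rcases le_total y x with h | h
  · have := hx₀ x ((le_max_left _ _).trans h)
    rw [div_lt_iff₀ (by linarith)] at this
    nlinarith
  · have := hmono x y (by linarith) h
    have h2 : 0 ≤ |L| := abs_nonneg L
    nlinarith

variable (K) in
/-- The Dedekind zeta function satisfies `ζ_K(1 + δ) ≪ 1 / δ`. -/
theorem exists_sum_rpow_le : ∃ C : ℝ, 0 < C ∧ ∀ δ : ℝ, 0 < δ → δ ≤ 1 →
    ∀ s : Finset (Ideal (𝓞 K)), ∑ c ∈ s, (Ideal.absNorm c : ℝ) ^ (-(1 + δ)) ≤ C / δ := by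
  classical
  obtain ⟨C, hC, hcard⟩ := exists_card_le K
  refine ⟨4 * C, by positivity, fun δ hδ hδ1 s => ?_⟩
  set t : ℝ := (1 / 2 : ℝ) ^ δ with ht
  have ht0 : 0 < t := by positivity
  have ht1 : t ≤ 1 - δ / 2 := by
    have := rpow_one_add_le_one_add_mul_self (s := -1 / 2) (by norm_num) hδ.le hδ1
    norm_num at this
    rw [ht]
    norm_num
    linarith
  set g : Ideal (𝓞 K) → ℕ := fun c => Nat.log 2 (Ideal.absNorm c)
  have hterm : ∀ c : Ideal (𝓞 K),
      (Ideal.absNorm c : ℝ) ^ (-(1 + δ)) ≤ (1 / 2 : ℝ) ^ g c * t ^ g c := by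
    intro c
    by_cases hc : Ideal.absNorm c = 0
    · rw [hc, Nat.cast_zero, Real.zero_rpow (by linarith)]
      positivity
    · have h1 : (2 : ℝ) ^ g c ≤ Ideal.absNorm c := by exact_mod_cast Nat.pow_log_le_self 2 hc
      calc (Ideal.absNorm c : ℝ) ^ (-(1 + δ)) ≤ ((2 : ℝ) ^ g c) ^ (-(1 + δ)) :=
            Real.rpow_le_rpow_of_nonpos (by positivity) h1 (by linarith)
        _ = (1 / 2 : ℝ) ^ g c * t ^ g c := by
            rw [ht, ← mul_pow, ← Real.rpow_natCast, ← Real.rpow_natCast, ← Real.rpow_mul two_pos.le,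
              mul_comm (g c : ℝ), Real.rpow_mul two_pos.le]
            congr 1
            rw [Real.rpow_neg two_pos.le, Real.rpow_add two_pos, Real.rpow_one, one_div,
              Real.inv_rpow two_pos.le, mul_inv]
  set M := s.sup g + 1
  have hmaps : ∀ c ∈ s, g c ∈ Finset.range M := fun c hc =>
    Finset.mem_range.2 (Nat.lt_succ_of_le (Finset.le_sup hc))
  calc ∑ c ∈ s, (Ideal.absNorm c : ℝ) ^ (-(1 + δ))
      ≤ ∑ c ∈ s, (1 / 2 : ℝ) ^ g c * t ^ g c := Finset.sum_le_sum fun c _ => hterm c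
    _ = ∑ k ∈ Finset.range M, ∑ c ∈ s with g c = k, (1 / 2 : ℝ) ^ g c * t ^ g c :=
        (Finset.sum_fiberwise_of_maps_to hmaps _).symm
    _ ≤ ∑ k ∈ Finset.range M, 2 * C * t ^ k := by
        refine Finset.sum_le_sum fun k _ => ?_
        have h1 : ∑ c ∈ s with g c = k, (1 / 2 : ℝ) ^ g c * t ^ g c =
            (s.filter fun c => g c = k).card * ((1 / 2 : ℝ) ^ k * t ^ k) := by
          rw [← nsmul_eq_mul, ← Finset.sum_const]
          exact Finset.sum_congr rfl fun c hc => by rw [(Finset.mem_filter.1 hc).2]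
        have h2 : ((s.filter fun c => g c = k).card : ℝ) ≤ C * 2 ^ (k + 1) := by
          refine hcard _ (one_le_pow₀ one_le_two) _ fun c hc => ?_
          have := (Nat.lt_pow_succ_log_self (b := 2) (by norm_num) (Ideal.absNorm c)).le
          rw [show Nat.log 2 (Ideal.absNorm c) = k from (Finset.mem_filter.1 hc).2] at this
          exact_mod_cast this
        rw [h1]
        calc _ ≤ C * 2 ^ (k + 1) * ((1 / 2 : ℝ) ^ k * t ^ k) := by gcongr
          _ = 2 * C * t ^ k := by
            rw [one_div, inv_pow, pow_succ]
            field_simp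
    _ ≤ 2 * C * (1 / (δ / 2)) := by
        rw [← Finset.mul_sum]
        gcongr
        have h1 : t < 1 := by linarith
        rw [geom_sum_eq h1.ne, ← neg_div_neg_eq]
        have h2 : 0 < t ^ M := by positivity
        rw [div_le_div_iff₀ (by linarith) (by linarith)]
        nlinarith
    _ = 4 * C / δ := by
        field_simp
        ring

open Classical in
theorem tsum_coprime_eq {σ : ℝ}
    (hsum : Summable fun c : Ideal (𝓞 K) => (Ideal.absNorm c : ℝ) ^ (-σ))
    (F : Finset (Ideal (𝓞 K))) (hF : ∀ p ∈ F, Prime p) :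
    ∑' c : Ideal (𝓞 K), (if ∀ p ∈ F, ¬ p ∣ c then (Ideal.absNorm c : ℝ) ^ (-σ) else 0) =
      (∏ p ∈ F, (1 - (Ideal.absNorm p : ℝ) ^ (-σ))) *
        ∑' c : Ideal (𝓞 K), (Ideal.absNorm c : ℝ) ^ (-σ) := by
  induction F using Finset.induction_on with
  | empty => simp
  | insert p F hpF ih =>
    have hp : Prime p := hF p (Finset.mem_insert_self _ _)
    have hF' : ∀ q ∈ F, Prime q := fun q hq => hF q (Finset.mem_insert_of_mem hq)
    set h : Ideal (𝓞 K) → ℝ :=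
      fun c => if ∀ q ∈ F, ¬ q ∣ c then (Ideal.absNorm c : ℝ) ^ (-σ) else 0 with hh
    have hnn : ∀ c : Ideal (𝓞 K), 0 ≤ (Ideal.absNorm c : ℝ) ^ (-σ) := fun c => by positivity
    have hs : Summable h := hsum.of_nonneg_of_le
      (fun c => by simp only [hh]; split_ifs <;> simp [hnn]) fun c => by
        simp only [hh]; split_ifs <;> simp [hnn]
    set h' : Ideal (𝓞 K) → ℝ := fun c => if p ∣ c then h c else 0 with hh'
    have hs' : Summable h' := hs.of_nonneg_of_le
      (fun c => by simp only [hh, hh']; split_ifs <;> simp [hnn]) fun c => by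
        simp only [hh, hh']; split_ifs <;> simp [hnn]
    have hshift : ∑' c, h' c = (Ideal.absNorm p : ℝ) ^ (-σ) * ∑' c, h c := by
      have hinj : Function.Injective fun c : Ideal (𝓞 K) => p * c :=
        mul_right_injective₀ hp.ne_zero
      rw [← hinj.tsum_eq, ← tsum_mul_left]
      · refine tsum_congr fun c => ?_
        simp only [hh', dvd_mul_right, if_true, hh]
        have hiff : (∀ q ∈ F, ¬ q ∣ p * c) ↔ ∀ q ∈ F, ¬ q ∣ c := by
          refine forall₂_congr fun q hq => not_congr ?_
          rw [(hF' q hq).dvd_mul, or_iff_right]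
          intro hqp
          exact hpF (associated_iff_eq.1 ((hF' q hq).associated_of_dvd hp hqp) ▸ hq)
        rw [if_congr hiff rfl rfl, map_mul, Nat.cast_mul,
          Real.mul_rpow (Nat.cast_nonneg _) (Nat.cast_nonneg _), mul_ite, mul_zero]
      · intro c hc
        by_contra hcon
        refine hc (if_neg fun hd => hcon ?_)
        obtain ⟨d, rfl⟩ := hd
        exact ⟨d, rfl⟩
    have hsplit : ∀ c : Ideal (𝓞 K), (if ∀ q ∈ insert p F, ¬ q ∣ c then
        (Ideal.absNorm c : ℝ) ^ (-σ) else 0) = h c - h' c := by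
      intro c
      simp only [Finset.forall_mem_insert, hh, hh']
      by_cases h1 : p ∣ c <;> by_cases h2 : ∀ q ∈ F, ¬ q ∣ c <;> simp [h1, h2]
    have ih' := ih hF'
    calc _ = ∑' c, (h c - h' c) := tsum_congr hsplit
      _ = ∑' c, h c - ∑' c, h' c := hs.tsum_sub hs'
      _ = _ := by
        rw [hshift, Finset.prod_insert hpF, show ∑' c, h c = _ from ih']
        ring

variable (K) in
theorem exists_le_prod : ∃ C : ℝ, 0 < C ∧ ∀ δ : ℝ, 0 < δ → δ ≤ 1 →
    ∀ F : Finset (Ideal (𝓞 K)), (∀ p ∈ F, Prime p) →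
      δ / C ≤ ∏ p ∈ F, (1 - (Ideal.absNorm p : ℝ) ^ (-(1 + δ))) := by
  classical
  obtain ⟨C, hC, hsum⟩ := exists_sum_rpow_le K
  refine ⟨C, hC, fun δ hδ hδ1 F hF => ?_⟩
  have hs : Summable fun c : Ideal (𝓞 K) => (Ideal.absNorm c : ℝ) ^ (-(1 + δ)) :=
    summable_of_sum_le (fun c => by positivity) (hsum δ hδ hδ1)
  have hle : ∑' c : Ideal (𝓞 K), (Ideal.absNorm c : ℝ) ^ (-(1 + δ)) ≤ C / δ :=
    hs.tsum_le_of_sum_le (hsum δ hδ hδ1)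
  have hone : 1 ≤ ∑' c : Ideal (𝓞 K),
      (if ∀ p ∈ F, ¬ p ∣ c then (Ideal.absNorm c : ℝ) ^ (-(1 + δ)) else 0) := by
    have hnn : ∀ c : Ideal (𝓞 K), 0 ≤
        if ∀ p ∈ F, ¬ p ∣ c then (Ideal.absNorm c : ℝ) ^ (-(1 + δ)) else 0 := fun c => by
      split_ifs <;> positivity
    have hs' := hs.of_nonneg_of_le (g := fun c : Ideal (𝓞 K) =>
      if ∀ p ∈ F, ¬ p ∣ c then (Ideal.absNorm c : ℝ) ^ (-(1 + δ)) else 0) hnn fun c => by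
        split_ifs
        · rfl
        · positivity
    refine le_trans ?_ (hs'.le_tsum 1 fun c _ => hnn c)
    rw [if_pos fun p hp h => (hF p hp).not_isUnit (isUnit_of_dvd_one h)]
    simp
  rw [tsum_coprime_eq hs F hF] at hone
  have hpos : 0 ≤ ∏ p ∈ F, (1 - (Ideal.absNorm p : ℝ) ^ (-(1 + δ))) := by
    refine Finset.prod_nonneg fun p hp => sub_nonneg.2 ?_
    refine Real.rpow_le_one_of_one_le_of_nonpos ?_ (by linarith)
    exact_mod_cast one_le_absNorm (hF p hp).ne_zero
  rw [div_le_iff₀ hC]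
  have := hone.trans (mul_le_mul_of_nonneg_left hle hpos)
  rw [mul_div_assoc', le_div_iff₀ hδ] at this
  linarith

/-! ### Mertens' upper bounds -/

theorem sum_log_div_le {M : ℕ} (hM : 1 ≤ M) :
    ∑ p ∈ Nat.primesBelow M, Real.log p / p ≤ Real.log M + Real.log 4 := by
  have hM0 : (0 : ℝ) < M := by exact_mod_cast hM
  have hprime : ∀ p ∈ Nat.primesBelow M, p.Prime := fun p hp => Nat.prime_of_mem_primesBelow hp
  have h1 : ∑ p ∈ Nat.primesBelow M, ((M / p : ℕ) : ℝ) * Real.log p ≤ Real.log (M.factorial) := by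
    rw [Real.log_nat_eq_sum_factorization, Finsupp.sum]
    refine (Finset.sum_le_sum fun p hp => ?_).trans (Finset.sum_le_sum_of_subset_of_nonneg
      (f := fun p => ((M.factorial.factorization p : ℕ) : ℝ) * Real.log p) ?_ fun p _ _ => ?_)
    · gcongr
      · rw [Nat.factorization_factorial (hprime p hp) (b := Nat.log p M + 2) (by omega)]
        refine le_trans (by simp) (Finset.single_le_sum (f := fun i => M / p ^ i)
          (fun i _ => Nat.zero_le _) (Finset.mem_Ico.2 ⟨le_rfl, by omega⟩))
    · intro p hp
      rw [Nat.support_factorization, Nat.mem_primeFactors]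
      exact ⟨hprime p hp, (hprime p hp).dvd_factorial.2 (Nat.lt_of_mem_primesBelow hp).le,
        Nat.factorial_ne_zero M⟩
    · exact mul_nonneg (Nat.cast_nonneg _) (Real.log_natCast_nonneg _)
  have h2 : Real.log (M.factorial) ≤ M * Real.log M := by
    rw [← Real.log_pow]
    exact Real.log_le_log (by exact_mod_cast Nat.factorial_pos M)
      (by exact_mod_cast Nat.factorial_le_pow M)
  have h3 : ∑ p ∈ Nat.primesBelow M, Real.log p ≤ Real.log 4 * M := by
    refine le_trans ?_ (Chebyshev.theta_le_log4_mul_x hM0.le)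
    rw [Chebyshev.theta_eq_sum_primesLE_log]
    refine Finset.sum_le_sum_of_subset_of_nonneg (fun p hp => ?_)
      fun p _ _ => Real.log_natCast_nonneg _
    rw [Nat.mem_primesLE]
    exact ⟨(Nat.lt_of_mem_primesBelow hp).le, hprime p hp⟩
  have h4 : M * ∑ p ∈ Nat.primesBelow M, Real.log p / p ≤
      ∑ p ∈ Nat.primesBelow M, ((M / p : ℕ) : ℝ) * Real.log p +
        ∑ p ∈ Nat.primesBelow M, Real.log p := by
    rw [Finset.mul_sum, ← Finset.sum_add_distrib]
    refine Finset.sum_le_sum fun p hp => ?_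
    have hp0 : (0 : ℝ) < p := by exact_mod_cast (hprime p hp).pos
    have : (M : ℝ) / p ≤ (M / p : ℕ) + 1 := by
      rw [div_le_iff₀ hp0]
      have := Nat.lt_mul_div_succ M (hprime p hp).pos
      exact_mod_cast (by linarith : M ≤ (M / p + 1) * p)
    have hlog : 0 ≤ Real.log p := Real.log_natCast_nonneg _
    calc (M : ℝ) * (Real.log p / p) = M / p * Real.log p := by ring
      _ ≤ ((M / p : ℕ) + 1) * Real.log p := by gcongr
      _ = _ := by ring
  have h5 : M * ∑ p ∈ Nat.primesBelow M, Real.log p / p ≤ M * (Real.log M + Real.log 4) := by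
    linarith
  exact le_of_mul_le_mul_left h5 hM0

/-! ### Prime ideals dividing a rational integer -/

open Classical in
variable (K) in
/-- The prime ideals dividing the integer `m`. -/
def primesOver (m : ℕ) : Finset (Ideal (𝓞 K)) :=
  (UniqueFactorizationMonoid.normalizedFactors (Ideal.span {(m : 𝓞 K)})).toFinset

theorem span_natCast_ne_zero {m : ℕ} (hm : m ≠ 0) : Ideal.span {(m : 𝓞 K)} ≠ 0 := by
  rw [Ideal.zero_eq_bot, Ne, Ideal.span_singleton_eq_bot]
  exact_mod_cast hm

theorem mem_primesOver {m : ℕ} (hm : m ≠ 0) {p : Ideal (𝓞 K)} :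
    p ∈ primesOver K m ↔ Prime p ∧ p ∣ Ideal.span {(m : 𝓞 K)} := by
  rw [primesOver, Multiset.mem_toFinset,
    UniqueFactorizationMonoid.mem_normalizedFactors_iff (span_natCast_ne_zero hm)]

theorem mem_primesOver_of_isMaximal {m : ℕ} (hm : m ≠ 0) {p : Ideal (𝓞 K)} (hp : p.IsMaximal)
    (h : Ideal.span {(m : 𝓞 K)} ≤ p) : p ∈ primesOver K m := by
  have hp0 : p ≠ ⊥ := by
    rintro rfl
    exact span_natCast_ne_zero hm (le_bot_iff.1 h)
  exact (mem_primesOver hm).2 ⟨Ideal.prime_of_isPrime hp0 hp.isPrime, Ideal.dvd_iff_le.2 h⟩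

theorem sup_span_eq_top_iff {m : ℕ} (hm : m ≠ 0) (c : Ideal (𝓞 K)) :
    c ⊔ Ideal.span {(m : 𝓞 K)} = ⊤ ↔ ∀ p ∈ primesOver K m, ¬ p ∣ c := by
  constructor
  · intro h p hp hpc
    obtain ⟨hp, hpm⟩ := (mem_primesOver hm).1 hp
    refine hp.not_isUnit (Ideal.isUnit_iff.2 (top_le_iff.1 ?_))
    rw [← h]
    exact sup_le (Ideal.dvd_iff_le.1 hpc) (Ideal.dvd_iff_le.1 hpm)
  · intro h
    by_contra hne
    obtain ⟨p, hp, hle⟩ := Ideal.exists_le_maximal _ hne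
    exact h p (mem_primesOver_of_isMaximal hm hp (le_sup_right.trans hle))
      (Ideal.dvd_iff_le.2 (le_sup_left.trans hle))

theorem two_le_absNorm {p : Ideal (𝓞 K)} (hp : Prime p) : 2 ≤ Ideal.absNorm p := by
  have h1 := one_le_absNorm (K := K) hp.ne_zero
  have h2 : Ideal.absNorm p ≠ 1 := fun h =>
    hp.not_isUnit (Ideal.isUnit_iff.2 (Ideal.absNorm_eq_one_iff.1 h))
  omega

theorem absNorm_span_natCast (m : ℕ) :
    Ideal.absNorm (Ideal.span {(m : 𝓞 K)}) = m ^ Module.finrank ℚ K := by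
  rw [Ideal.absNorm_span_natCast, RingOfIntegers.rank]

/-- The number of elements of a finite group that a surjection maps into a given set. -/
theorem card_preimage_mul_card {A B : Type*} [AddGroup A] [AddGroup B] [Fintype A] [Fintype B]
    [DecidableEq B] (f : A →+ B) (hf : Function.Surjective f) (T : Finset B) :
    (Finset.univ.filter fun a => f a ∈ T).card * Fintype.card B = T.card * Fintype.card A := by
  have hfib : ∀ b : B, (Finset.univ.filter fun a => f a = b).card =
      (Finset.univ.filter fun a => f a = 0).card := fun b =>
    AddMonoidHom.card_fiber_eq_of_mem_range f (hf b) (hf 0)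
  have h1 : (Finset.univ.filter fun a => f a ∈ T).card =
      T.card * (Finset.univ.filter fun a => f a = 0).card := by
    rw [Finset.card_eq_sum_card_fiberwise (f := f) (t := T) (fun a ha => by simpa using ha),
      Finset.sum_const_nat]
    intro b hb
    rw [← hfib b, Finset.filter_filter]
    congr 1
    ext a
    simp only [Finset.mem_filter, Finset.mem_univ, true_and, and_iff_right_iff_imp]
    rintro rfl
    exact hb
  have h2 : Fintype.card A =
      Fintype.card B * (Finset.univ.filter fun a => f a = 0).card := by
    rw [← Finset.card_univ, Finset.card_eq_sum_card_fiberwise (f := f) (t := Finset.univ)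
      (fun a _ => by simp), Finset.sum_const_nat fun b _ => hfib b, Finset.card_univ]
  rw [h1, h2]
  ring

theorem totient_mul_prod {m : ℕ} (hm : m ≠ 0) :
    totient K m * ∏ p ∈ primesOver K m, Ideal.absNorm p =
      (∏ p ∈ primesOver K m, (Ideal.absNorm p - 1)) * m ^ Module.finrank ℚ K := by
  classical
  set I : Ideal (𝓞 K) := Ideal.span {(m : 𝓞 K)} with hI
  have hI0 : I ≠ ⊥ := span_natCast_ne_zero hm
  have hfinI : Finite (𝓞 K ⧸ I) := Ideal.finiteQuotientOfFreeOfNeBot I hI0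
  let P : primesOver K m → Ideal (𝓞 K) := Subtype.val
  have hP : ∀ i, Prime (P i) ∧ P i ∣ I := fun i => (mem_primesOver hm).1 i.2
  have hfin : ∀ i, Finite (𝓞 K ⧸ P i) := fun i =>
    Ideal.finiteQuotientOfFreeOfNeBot (P i) (hP i).1.ne_zero
  have hmax : ∀ i, (P i).IsMaximal := fun i =>
    (Ideal.isPrime_of_prime (hP i).1).isMaximal (hP i).1.ne_zero
  have hcop : Pairwise fun i j => IsCoprime (P i) (P j) := fun i j hij => by
    refine Ideal.isCoprime_iff_sup_eq.2 ?_
    exact (hmax i).coprime_of_ne (hmax j) fun h => hij (Subtype.ext h)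
  let := Fintype.ofFinite (𝓞 K ⧸ I)
  let : ∀ i, Fintype (𝓞 K ⧸ P i) := fun i => Fintype.ofFinite _
  let f : 𝓞 K ⧸ I →+* ∀ i, 𝓞 K ⧸ P i :=
    RingHom.pi fun i => Ideal.Quotient.factor (Ideal.dvd_iff_le.1 (hP i).2)
  have hf : Function.Surjective f := by
    intro y
    obtain ⟨x, hx⟩ := Ideal.quotientInfToPiQuotient_surj hcop y
    obtain ⟨x, rfl⟩ := Ideal.Quotient.mk_surjective x
    refine ⟨Ideal.Quotient.mk I x, ?_⟩
    rw [← hx]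
    rfl
  let T : Finset (∀ i, 𝓞 K ⧸ P i) := Fintype.piFinset fun i => Finset.univ.erase 0
  have hunit : ∀ a : 𝓞 K ⧸ I, IsUnit a ↔ f a ∈ T := by
    intro a
    obtain ⟨x, rfl⟩ := Ideal.Quotient.mk_surjective a
    simp only [T, Fintype.mem_piFinset, Finset.mem_erase, Finset.mem_univ, and_true]
    constructor
    · intro h i
      have := (hmax i).ne_top
      have : Nontrivial (𝓞 K ⧸ P i) := Ideal.Quotient.nontrivial_iff.2 this
      exact ((h.map f).map (Pi.evalRingHom _ i)).ne_zero
    · intro h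
      by_contra hx
      obtain ⟨M, hM, hxM⟩ := exists_max_ideal_of_mem_nonunits hx
      have hM' : (M.comap (Ideal.Quotient.mk I)).IsMaximal :=
        Ideal.comap_isMaximal_of_surjective _ Ideal.Quotient.mk_surjective
      have hle : I ≤ M.comap (Ideal.Quotient.mk I) := fun y hy => by
        rw [Ideal.mem_comap, Ideal.Quotient.eq_zero_iff_mem.2 hy]
        exact M.zero_mem
      refine h ⟨_, mem_primesOver_of_isMaximal hm hM' hle⟩ ?_
      exact Ideal.Quotient.eq_zero_iff_mem.2 hxM
  have hcount := card_preimage_mul_card f.toAddMonoidHom hf T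
  have h1 : totient K m = (Finset.univ.filter fun a => f.toAddMonoidHom a ∈ T).card := by
    rw [totient, ← Fintype.card_subtype, ← Nat.card_eq_fintype_card]
    refine Nat.card_congr ((Equiv.ofBijective (fun u : (𝓞 K ⧸ I)ˣ =>
      (⟨u, (hunit _).1 u.isUnit⟩ : {a // f.toAddMonoidHom a ∈ T})) ⟨fun u v h => ?_, ?_⟩))
    · exact Units.ext (Subtype.ext_iff.1 h)
    · rintro ⟨a, ha⟩
      exact ⟨((hunit a).2 ha).unit, rfl⟩
  have hc : ∀ i, Fintype.card (𝓞 K ⧸ P i) = Ideal.absNorm (P i) := fun i => by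
    rw [Ideal.absNorm_apply, Submodule.cardQuot_apply, Nat.card_eq_fintype_card]
  have h2 : Fintype.card (∀ i, 𝓞 K ⧸ P i) = ∏ p ∈ primesOver K m, Ideal.absNorm p := by
    rw [Fintype.card_pi, Finset.prod_congr rfl fun i _ => hc i]
    exact Finset.prod_coe_sort (primesOver K m) fun p => Ideal.absNorm p
  have h3 : T.card = ∏ p ∈ primesOver K m, (Ideal.absNorm p - 1) := by
    rw [Fintype.card_piFinset,
      ← Finset.prod_coe_sort (primesOver K m) fun p => Ideal.absNorm p - 1]
    refine Finset.prod_congr rfl fun i _ => ?_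
    rw [Finset.card_erase_of_mem (Finset.mem_univ _), Finset.card_univ, hc]
  have h4 : Fintype.card (𝓞 K ⧸ I) = m ^ Module.finrank ℚ K := by
    rw [← absNorm_span_natCast (K := K), Ideal.absNorm_apply, Submodule.cardQuot_apply,
      Nat.card_eq_fintype_card]
  rw [h1, ← h2, ← h3, ← h4]
  exact hcount

theorem pow_div_totient {m : ℕ} (hm : m ≠ 0) :
    (m : ℝ) ^ Module.finrank ℚ K / totient K m =
      (∏ p ∈ primesOver K m, (1 - (Ideal.absNorm p : ℝ)⁻¹))⁻¹ := by
  have hN : ∀ p ∈ primesOver K m, (2 : ℝ) ≤ Ideal.absNorm p := fun p hp => by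
    exact_mod_cast two_le_absNorm ((mem_primesOver hm).1 hp).1
  have h := congrArg (Nat.cast : ℕ → ℝ) (totient_mul_prod (K := K) hm)
  push_cast at h
  have h1 : ∏ p ∈ primesOver K m, ((Ideal.absNorm p - 1 : ℕ) : ℝ) =
      (∏ p ∈ primesOver K m, (1 - (Ideal.absNorm p : ℝ)⁻¹)) *
        ∏ p ∈ primesOver K m, (Ideal.absNorm p : ℝ) := by
    rw [← Finset.prod_mul_distrib]
    refine Finset.prod_congr rfl fun p hp => ?_
    have := hN p hp
    rw [Nat.cast_sub (by exact_mod_cast (by linarith : (1 : ℝ) ≤ Ideal.absNorm p)), Nat.cast_one,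
      sub_mul, one_mul, inv_mul_cancel₀ (by positivity)]
  have h2 : ∏ p ∈ primesOver K m, (Ideal.absNorm p : ℝ) ≠ 0 :=
    Finset.prod_ne_zero_iff.2 fun p hp => by
      have := hN p hp
      positivity
  have h3 : ∏ p ∈ primesOver K m, (1 - (Ideal.absNorm p : ℝ)⁻¹) ≠ 0 :=
    Finset.prod_ne_zero_iff.2 fun p hp => by
      have := hN p hp
      have : (Ideal.absNorm p : ℝ)⁻¹ < 1 := inv_lt_one_of_one_lt₀ (by linarith)
      linarith
  have h4 : (totient K m : ℝ) =
      (∏ p ∈ primesOver K m, (1 - (Ideal.absNorm p : ℝ)⁻¹)) * (m : ℝ) ^ Module.finrank ℚ K := by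
    refine mul_right_cancel₀ h2 ?_
    rw [h, h1]
    ring
  have h5 : (m : ℝ) ^ Module.finrank ℚ K ≠ 0 := pow_ne_zero _ (by exact_mod_cast hm)
  rw [h4]
  field_simp

theorem primeProd_ne_zero (z : ℝ) : primeProd z ≠ 0 :=
  Finset.prod_ne_zero_iff.2 fun _ hp => (Nat.prime_of_mem_primesBelow hp).ne_zero

theorem exists_dvd_span {z : ℝ} {p : Ideal (𝓞 K)} (hp : p ∈ primesOver K (primeProd z)) :
    ∃ ℓ ∈ Nat.primesBelow ⌈z⌉₊, p ∣ Ideal.span {(ℓ : 𝓞 K)} := by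
  obtain ⟨hp, hdvd⟩ := (mem_primesOver (primeProd_ne_zero z)).1 hp
  have h : Ideal.span {((primeProd z : ℕ) : 𝓞 K)} =
      ∏ ℓ ∈ Nat.primesBelow ⌈z⌉₊, Ideal.span {((ℓ : ℕ) : 𝓞 K)} := by
    rw [Ideal.prod_span_singleton, primeProd, Nat.cast_prod]
  rw [h] at hdvd
  exact (hp.dvd_finsetProd_iff _).1 hdvd

theorem absNorm_le_of_mem_primesOver {z : ℝ} {p : Ideal (𝓞 K)}
    (hp : p ∈ primesOver K (primeProd z)) : (Ideal.absNorm p : ℝ) ≤ z ^ Module.finrank ℚ K := by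
  obtain ⟨ℓ, hℓ, hdvd⟩ := exists_dvd_span hp
  have h1 := absNorm_le_of_dvd
    (span_natCast_ne_zero (Nat.prime_of_mem_primesBelow hℓ).ne_zero) hdvd
  rw [absNorm_span_natCast] at h1
  have h2 : (ℓ : ℝ) ≤ z := (Nat.lt_ceil.1 (Nat.lt_of_mem_primesBelow hℓ)).le
  calc (Ideal.absNorm p : ℝ) ≤ (ℓ : ℝ) ^ Module.finrank ℚ K := by exact_mod_cast h1
    _ ≤ _ := by gcongr

theorem sum_log_absNorm_div_le {z : ℝ} (hz : 1 ≤ z) :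
    ∑ p ∈ primesOver K (primeProd z), Real.log (Ideal.absNorm p) / Ideal.absNorm p ≤
      Module.finrank ℚ K * (3 * (1 + Real.log z)) := by
  classical
  have hex : ∀ p : Ideal (𝓞 K), ∃ ℓ, p ∈ primesOver K (primeProd z) →
      ℓ ∈ Nat.primesBelow ⌈z⌉₊ ∧ p ∣ Ideal.span {(ℓ : 𝓞 K)} := fun p => by
    by_cases hp : p ∈ primesOver K (primeProd z)
    · obtain ⟨ℓ, h⟩ := exists_dvd_span hp
      exact ⟨ℓ, fun _ => h⟩
    · exact ⟨0, fun h => absurd h hp⟩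
  choose g hg using hex
  have hprime : ∀ p ∈ primesOver K (primeProd z), Prime p := fun p hp =>
    ((mem_primesOver (primeProd_ne_zero z)).1 hp).1
  have hfiber : ∀ ℓ ∈ Nat.primesBelow ⌈z⌉₊,
      ∑ p ∈ primesOver K (primeProd z) with g p = ℓ,
        Real.log (Ideal.absNorm p) / Ideal.absNorm p ≤
      Module.finrank ℚ K * (Real.log ℓ / ℓ) := by
    intro ℓ hℓ
    have hℓp := Nat.prime_of_mem_primesBelow hℓ
    have hℓ0 : (0 : ℝ) < ℓ := by exact_mod_cast hℓp.pos
    set s := (primesOver K (primeProd z)).filter fun p => g p = ℓ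
    have hs : ∀ p ∈ s, Prime p ∧ p ∣ Ideal.span {(ℓ : 𝓞 K)} := fun p hp => by
      obtain ⟨h1, h2⟩ := Finset.mem_filter.1 hp
      exact ⟨hprime p h1, h2 ▸ (hg p h1).2⟩
    have hge : ∀ p ∈ s, (ℓ : ℝ) ≤ Ideal.absNorm p := fun p hp => by
      have hd := map_dvd Ideal.absNorm (hs p hp).2
      rw [absNorm_span_natCast, Nat.dvd_prime_pow hℓp] at hd
      obtain ⟨j, -, hj⟩ := hd
      have h2 := two_le_absNorm (hs p hp).1
      have hj0 : j ≠ 0 := by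
        rintro rfl
        rw [pow_zero] at hj
        omega
      rw [hj]
      exact_mod_cast Nat.le_self_pow hj0 ℓ
    have hprod : ∑ p ∈ s, Real.log (Ideal.absNorm p) ≤ Module.finrank ℚ K * Real.log ℓ := by
      have hd : ∏ p ∈ s, p ∣ Ideal.span {(ℓ : 𝓞 K)} :=
        Finset.prod_primes_dvd _ (fun p hp => (hs p hp).1) fun p hp => (hs p hp).2
      have hle := absNorm_le_of_dvd (span_natCast_ne_zero hℓp.ne_zero) hd
      rw [absNorm_span_natCast, map_prod] at hle
      rw [← Real.log_pow, ← Real.log_prod fun p hp => by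
        have := (hℓ0.trans_le (hge p hp)).ne'
        exact this]
      refine Real.log_le_log (Finset.prod_pos fun p hp => hℓ0.trans_le (hge p hp)) ?_
      exact_mod_cast hle
    calc ∑ p ∈ s, Real.log (Ideal.absNorm p) / Ideal.absNorm p
        ≤ ∑ p ∈ s, Real.log (Ideal.absNorm p) / ℓ := by
          refine Finset.sum_le_sum fun p hp => ?_
          exact div_le_div_of_nonneg_left (log_absNorm_nonneg p) hℓ0 (hge p hp)
      _ = (∑ p ∈ s, Real.log (Ideal.absNorm p)) / ℓ := by rw [Finset.sum_div]
      _ ≤ Module.finrank ℚ K * Real.log ℓ / ℓ := by gcongr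
      _ = _ := by ring
  have hM : 1 ≤ ⌈z⌉₊ := Nat.one_le_iff_ne_zero.2 (Nat.ceil_pos.2 (by linarith)).ne'
  have hMz : Real.log ⌈z⌉₊ ≤ Real.log 2 + Real.log z := by
    rw [← Real.log_mul (by norm_num) (by linarith)]
    exact Real.log_le_log (by exact_mod_cast hM) (by
      have := Nat.ceil_lt_add_one (show 0 ≤ z by linarith)
      linarith)
  have hlog4 : Real.log 4 = 2 * Real.log 2 := by
    rw [show (4 : ℝ) = 2 ^ 2 by norm_num, Real.log_pow]
    norm_num
  have hlog2 := Real.log_two_lt_d9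
  have hlogz := Real.log_nonneg hz
  rw [← Finset.sum_fiberwise_of_maps_to (g := g) (fun p hp => (hg p hp).1)]
  refine (Finset.sum_le_sum hfiber).trans ?_
  rw [← Finset.mul_sum]
  gcongr
  refine (sum_log_div_le hM).trans ?_
  linarith

variable (K) in
/-- An upper bound of Mertens type for the constant in the Cramér model. -/
theorem exists_cramer_const_le : ∃ C : ℝ, 0 < C ∧ ∀ z : ℝ, 1 ≤ z →
    1 / dedekindZeta_residue K *
      ((primeProd z : ℝ) ^ Module.finrank ℚ K / totient K (primeProd z)) ≤
        C * (1 + Real.log z) := by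
  obtain ⟨C, hC, hprod⟩ := exists_le_prod K
  have hres := dedekindZeta_residue_pos K
  refine ⟨1 / dedekindZeta_residue K * (C * Real.exp (6 * Module.finrank ℚ K)), by positivity,
    fun z hz => ?_⟩
  rw [mul_assoc, pow_div_totient (primeProd_ne_zero z)]
  refine mul_le_mul_of_nonneg_left ?_ (by positivity)
  have hlogz := Real.log_nonneg hz
  set δ : ℝ := 1 / (1 + Real.log z) with hδ
  have hδ0 : 0 < δ := by positivity
  have hδ1 : δ ≤ 1 := by
    rw [hδ, div_le_one (by linarith)]
    linarith
  have hN : ∀ p ∈ primesOver K (primeProd z), Prime p := fun p hp =>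
    ((mem_primesOver (primeProd_ne_zero z)).1 hp).1
  have hfac : ∀ p ∈ primesOver K (primeProd z), 1 - (Ideal.absNorm p : ℝ) ^ (-(1 + δ)) ≤
      (1 - (Ideal.absNorm p : ℝ)⁻¹) *
        Real.exp (2 * δ * (Real.log (Ideal.absNorm p) / Ideal.absNorm p)) := by
    intro p hp
    have h2 : (2 : ℝ) ≤ Ideal.absNorm p := by exact_mod_cast two_le_absNorm (hN p hp)
    set x : ℝ := (Ideal.absNorm p : ℝ)
    have hx0 : 0 < x := by linarith
    have hlogx : 0 ≤ Real.log x := Real.log_nonneg (by linarith)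
    have hinv : x⁻¹ ≤ 1 / 2 := by
      rw [one_div]
      exact inv_anti₀ two_pos h2
    have hpow : x ^ (-(1 + δ)) = x⁻¹ * Real.exp (-(δ * Real.log x)) := by
      rw [neg_add, Real.rpow_add hx0, Real.rpow_neg_one, Real.rpow_def_of_pos hx0]
      congr 2
      ring
    have h3 := Real.add_one_le_exp (-(δ * Real.log x))
    have h4 := Real.add_one_le_exp (2 * δ * (Real.log x / x))
    have h5 : 0 ≤ x⁻¹ := by positivity
    have h6 : 0 ≤ δ * Real.log x := by positivity
    rw [hpow]
    calc 1 - x⁻¹ * Real.exp (-(δ * Real.log x)) ≤ 1 - x⁻¹ * (-(δ * Real.log x) + 1) := by gcongr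
      _ ≤ (1 - x⁻¹) * (2 * δ * (Real.log x / x) + 1) := by
          rw [div_eq_mul_inv]
          nlinarith [mul_nonneg (mul_nonneg h5 h6) (sub_nonneg.2 hinv)]
      _ ≤ _ := by
          gcongr
          linarith
  have hpos : 0 < ∏ p ∈ primesOver K (primeProd z), (1 - (Ideal.absNorm p : ℝ)⁻¹) := by
    refine Finset.prod_pos fun p hp => sub_pos.2 (inv_lt_one_of_one_lt₀ ?_)
    exact_mod_cast (two_le_absNorm (hN p hp))
  have hle : δ / C ≤ (∏ p ∈ primesOver K (primeProd z), (1 - (Ideal.absNorm p : ℝ)⁻¹)) *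
      Real.exp (6 * Module.finrank ℚ K) := by
    refine (hprod δ hδ0 hδ1 _ hN).trans ((Finset.prod_le_prod (fun p hp => ?_) hfac).trans ?_)
    · refine sub_nonneg.2 (Real.rpow_le_one_of_one_le_of_nonpos ?_ (by linarith))
      exact_mod_cast one_le_absNorm (hN p hp).ne_zero
    · rw [Finset.prod_mul_distrib, ← Real.exp_sum, ← Finset.mul_sum]
      refine mul_le_mul_of_nonneg_left (Real.exp_le_exp.2 ?_) hpos.le
      calc 2 * δ * ∑ p ∈ primesOver K (primeProd z), Real.log (Ideal.absNorm p) / Ideal.absNorm p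
          ≤ 2 * δ * (Module.finrank ℚ K * (3 * (1 + Real.log z))) := by
            gcongr
            exact sum_log_absNorm_div_le hz
        _ = 6 * Module.finrank ℚ K := by
            rw [hδ]
            field_simp
            ring
  rw [inv_le_iff_one_le_mul₀ hpos]
  rw [hδ, div_div, div_le_iff₀ (by positivity)] at hle
  linarith

/-! ### Multiplicativity of Hecke characters on ideals -/

theorem Represents.mul {q c d : Ideal (𝓞 K)} (hc : c ≠ ⊥) (hd : d ≠ ⊥) {x y : Ideles K}
    (hx : Represents q c x) (hy : Represents q d y) : Represents q (c * d) (x * y) := by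
  have hinf : (x * y).inf = x.inf * y.inf := rfl
  have hfin : ∀ v, (x * y).fin v = x.fin v * y.fin v := fun _ => rfl
  refine ⟨by rw [hinf, hx.1, hy.1, mul_one], fun v => ⟨fun hv => ?_, ?_⟩⟩
  · rw [hfin, (hx.2 v).1 hv, (hy.2 v).1 hv, mul_one]
  · have hv : Prime v.asIdeal := v.prime
    rw [hfin, map_mul, (hx.2 v).2, (hy.2 v).2, ← WithZero.exp_add,
      multiplicity_mul hv (FiniteMultiplicity.of_prime_left hv (mul_ne_zero hc hd))]
    congr 1
    push_cast
    ring

theorem HeckeCharacter.idealValue_mul {ψ : HeckeCharacter K} {q : Ideal (𝓞 K)}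
    (hψ : ψ.IsModulus q) (c d : Ideal (𝓞 K)) (hc : c ≠ ⊥) (hd : d ≠ ⊥) :
    ψ.idealValue q (c * d) = ψ.idealValue q c * ψ.idealValue q d := by
  have hcd : c * d ≠ ⊥ := mul_ne_zero hc hd
  by_cases h : IsCoprime c q ∧ IsCoprime d q
  · obtain ⟨x, hx⟩ := exists_represents hc h.1
    obtain ⟨y, hy⟩ := exists_represents hd h.2
    rw [HeckeCharacter.idealValue_eq hψ hc h.1 hx, HeckeCharacter.idealValue_eq hψ hd h.2 hy,
      HeckeCharacter.idealValue_eq hψ hcd (IsCoprime.mul_left h.1 h.2) (hx.mul hc hd hy), map_mul,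
      Circle.coe_mul]
  · have h1 : ψ.idealValue q (c * d) = 0 :=
      dif_neg fun h' => h ⟨h'.2.of_mul_left_left, h'.2.of_mul_left_right⟩
    rw [h1]
    rcases not_and_or.1 h with h' | h'
    · rw [show ψ.idealValue q c = 0 from dif_neg fun h'' => h' h''.2, zero_mul]
    · rw [show ψ.idealValue q d = 0 from dif_neg fun h'' => h' h''.2, mul_zero]

theorem HeckeCharacter.norm_idealValue_le (ψ : HeckeCharacter K) (q c : Ideal (𝓞 K)) :
    ‖ψ.idealValue q c‖ ≤ 1 := by
  rw [HeckeCharacter.idealValue]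
  split_ifs
  · rw [Circle.norm_coe]
  · simp

/-! ### The Cramér and Siegel models -/

open Classical in
theorem card_filter_le {C : ℝ} (hC : ∀ x : ℝ, 1 ≤ x → ∀ s : Finset (Ideal (𝓞 K)),
    (∀ c ∈ s, (Ideal.absNorm c : ℝ) ≤ x) → (s.card : ℝ) ≤ C * x) {N : ℕ} {x : ℝ} (hx : 1 ≤ x)
    {P : IdealsLE K N → Prop} (hP : ∀ c, P c → (Ideal.absNorm c.1 : ℝ) ≤ x) :
    ((Finset.univ.filter P).card : ℝ) ≤ C * x := by
  rw [← Finset.card_image_of_injective _ (Subtype.val_injective (p := fun c : Ideal (𝓞 K) =>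
    c ≠ ⊥ ∧ Ideal.absNorm c ≤ N))]
  refine hC x hx _ fun c hc => ?_
  obtain ⟨d, hd, rfl⟩ := Finset.mem_image.1 hc
  exact hP d (Finset.mem_filter.1 hd).2

/-- For large `N` the error terms are negligible. -/
theorem exists_threshold (C n : ℝ) (hn : 0 ≤ n) : ∃ N₀ : ℕ, ∀ N : ℕ, 3 ≤ N → N₀ ≤ N →
    C * Real.exp (5 / 6 * Real.log N + n * Real.sqrt (Real.log N)) <
      N * Real.exp (-(1 / 10) * Real.sqrt (Real.log N)) := by
  set D : ℝ := |C| + 1 with hD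
  have hD1 : 1 ≤ D := by
    have := abs_nonneg C
    linarith
  have hlogD : 0 ≤ Real.log D := Real.log_nonneg hD1
  set X : ℝ := 6 * (Real.log D + n + 1) with hX
  refine ⟨⌈Real.exp (X ^ 2)⌉₊, fun N hN3 hN => ?_⟩
  have hN0 : (0 : ℝ) < N := by exact_mod_cast (by omega : 0 < N)
  have hlog := one_le_log hN3
  set x := Real.sqrt (Real.log N) with hx
  have hx2 : Real.log N = x ^ 2 := (Real.sq_sqrt (by linarith)).symm
  have hx1 : 1 ≤ x := Real.one_le_sqrt.2 hlog
  have hXx : X ≤ x := by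
    refine Real.le_sqrt_of_sq_le ?_
    rw [Real.le_log_iff_exp_le hN0]
    exact Nat.ceil_le.1 hN
  have hNexp : (N : ℝ) = Real.exp (x ^ 2) := by rw [← hx2, Real.exp_log hN0]
  calc C * Real.exp (5 / 6 * Real.log N + n * x)
      ≤ D * Real.exp (5 / 6 * Real.log N + n * x) := by
        gcongr
        linarith [le_abs_self C]
    _ = Real.exp (Real.log D + (5 / 6 * x ^ 2 + n * x)) := by
        rw [Real.exp_add (Real.log D), Real.exp_log (by linarith), hx2]
    _ < Real.exp (x ^ 2 + -(1 / 10) * x) := by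
        refine Real.exp_lt_exp.2 ?_
        have h1 : X * x ≤ x * x := mul_le_mul_of_nonneg_right hXx (by linarith)
        have h2 : Real.log D ≤ Real.log D * x := le_mul_of_one_le_right hlogD hx1
        rw [hX] at h1
        nlinarith
    _ = _ := by rw [Real.exp_add, hNexp]

open Classical in
variable (K) in
theorem exists_hasMass_cramer : ∃ (C : ℝ) (N₀ : ℕ), ∀ N : ℕ, 3 ≤ N → N₀ ≤ N → ∀ B : ℝ, 1 ≤ B →
    ∀ χ : Ideal (𝓞 K) → ℂ, (∀ c d, c ≠ ⊥ → d ≠ ⊥ → χ (c * d) = χ c * χ d) → (∀ c, ‖χ c‖ ≤ 1) →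
    ∀ β : ℝ, β ≤ 1 →
      HasMass (fun S : IdealsLE K N → ℂ => IsTwistedTypeOne χ S ∨ IsTypeTwo S ∨ IsNegligible S)
        (C * Real.log N) (fun c => (cramer (sieveLevel B N) c.1 : ℂ) *
          (χ c.1 * ((Ideal.absNorm c.1 : ℝ) ^ (β - 1) : ℝ))) := by
  obtain ⟨C₁, hC₁, hcoef⟩ := exists_cramer_const_le K
  obtain ⟨C₂, hC₂, hcount⟩ := exists_card_le K
  set n : ℝ := (Module.finrank ℚ K : ℝ) with hn
  have hn0 : 0 ≤ n := Nat.cast_nonneg _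
  obtain ⟨N₀, hN₀⟩ := exists_threshold C₂ n hn0
  set D : ℝ := C₂ + 1 with hD
  have hlogD : 0 ≤ Real.log D := Real.log_nonneg (by linarith)
  refine ⟨2 * C₁ * (14 * (Real.log D + n) + 18), N₀, fun N hN hNN B hB χ hmul hχ β hβ => ?_⟩
  have hN0 : (0 : ℝ) < N := by exact_mod_cast (by omega : 0 < N)
  have hlog := one_le_log hN
  set x := Real.sqrt (Real.log N) with hx
  have hx1 : 1 ≤ x := Real.one_le_sqrt.2 hlog
  have hxx : x * x = Real.log N := Real.mul_self_sqrt (by linarith)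
  set Q := sieveLevel B N with hQ
  have hlogQ : Real.log Q = x / B := Real.log_exp _
  have hlogQ0 : 0 ≤ Real.log Q := by
    rw [hlogQ]
    positivity
  have hlogQx : Real.log Q ≤ x := by
    rw [hlogQ]
    exact div_le_self (by linarith) hB
  have hQ1 : 1 ≤ Q := Real.one_le_exp (by rw [← hx, ← hlogQ]; exact hlogQ0)
  have hQn : Q ^ Module.finrank ℚ K ≤ Real.exp (n * x) := by
    rw [← Real.exp_log (show 0 < Q by linarith), ← Real.exp_nat_mul]
    exact Real.exp_le_exp.2 (mul_le_mul_of_nonneg_left hlogQx hn0)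
  have hm := primeProd_ne_zero Q
  obtain ⟨p, hinj, hmem⟩ := exists_prime_family (primesOver K (primeProd Q))
  let r := (primesOver K (primeProd Q)).card
  have hpmem : ∀ i, p i ∈ primesOver K (primeProd Q) := fun i => (hmem _).2 ⟨i, rfl⟩
  have hp : ∀ i, Prime (p i) := fun i => ((mem_primesOver hm).1 (hpmem i)).1
  have hpq : ∀ i, (Ideal.absNorm (p i) : ℝ) ≤ Real.exp (n * x) := fun i =>
    (absNorm_le_of_mem_primesOver (hpmem i)).trans hQn
  have hlabels : ∀ c : Ideal (𝓞 K), c ⊔ Ideal.span {(primeProd Q : 𝓞 K)} = ⊤ ↔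
      labels p c = ∅ := fun c => by
    rw [sup_span_eq_top_iff hm, Finset.eq_empty_iff_forall_notMem]
    simp only [mem_labels]
    exact ⟨fun h i => h _ (hpmem i), fun h q hq => by
      obtain ⟨i, rfl⟩ := (hmem q).1 hq
      exact h i⟩
  set k := Nat.log 2 r + 1 with hk
  have hk2 : r < 2 ^ k := Nat.lt_pow_succ_log_self one_lt_two r
  have hkle : (k : ℝ) ≤ 2 * (Real.log D + n * x) + 1 := by
    have h0 : ((Nat.log 2 r : ℕ) : ℝ) * Real.log 2 ≤ Real.log D + n * x := by
      rcases Nat.eq_zero_or_pos r with h | h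
      · rw [h]
        simpa using by positivity
      · rw [← Real.log_pow, ← Real.log_exp (n * x), ← Real.log_mul (by positivity) (by positivity)]
        refine Real.log_le_log (by positivity) ?_
        calc (2 : ℝ) ^ Nat.log 2 r ≤ r := by exact_mod_cast Nat.pow_log_le_self 2 h.ne'
          _ ≤ C₂ * Real.exp (n * x) := hcount _ (Real.one_le_exp (by positivity)) _ fun c hc =>
              (absNorm_le_of_mem_primesOver hc).trans hQn
          _ ≤ D * Real.exp (n * x) := by
              gcongr
              linarith
    have h1 := Real.log_two_gt_d9
    have h2 : (0 : ℝ) ≤ (Nat.log 2 r : ℕ) := Nat.cast_nonneg _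
    rw [hk]
    push_cast
    nlinarith
  set Y : ℝ := 2 / 3 * Real.log N + n * x with hY
  have hY' : (N : ℝ) ^ (2 / 3 : ℝ) * Real.exp (n * x) ≤ Real.exp Y := by
    rw [hY, Real.exp_add, Real.rpow_def_of_pos hN0, mul_comm (Real.log N)]
  have hcard : ((Finset.univ.filter fun c : IdealsLE K N =>
      Real.log (Ideal.absNorm c.1) ≤ Y + Real.log N / 6).card : ℝ) <
        N * Real.exp (-(1 / 10) * Real.sqrt (Real.log N)) := by
    refine lt_of_le_of_lt (card_filter_le hcount (x := Real.exp (Y + Real.log N / 6))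
      (Real.one_le_exp (by positivity)) fun c hc => ?_) (lt_of_eq_of_lt ?_ (hN₀ N hN hNN))
    · exact (Real.log_le_iff_le_exp (by exact_mod_cast one_le_absNorm c.2.1)).1 hc
    · rw [hY]
      congr 2
      ring
  have hsieve := hasMass_sieve hN hp hinj hk2 hpq hmul hχ hβ hY' hcard
  set a : ℝ := 1 / dedekindZeta_residue K *
    ((primeProd Q : ℝ) ^ Module.finrank ℚ K / totient K (primeProd Q)) with ha
  have ha0 : 0 ≤ a := by
    have := dedekindZeta_residue_pos K
    positivity
  have hax : a ≤ 2 * C₁ * x := by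
    have := hcoef Q hQ1
    nlinarith
  have hmass : ‖(a : ℂ)‖ * (7 * (k + 1) + 4) ≤
      2 * C₁ * (14 * (Real.log D + n) + 18) * Real.log N := by
    rw [Complex.norm_real, Real.norm_of_nonneg ha0, ← hxx]
    have h1 : 7 * ((k : ℝ) + 1) + 4 ≤ (14 * (Real.log D + n) + 18) * x := by nlinarith
    calc a * (7 * (k + 1) + 4) ≤ (2 * C₁ * x) * ((14 * (Real.log D + n) + 18) * x) := by gcongr
      _ = _ := by ring
  convert (hsieve.const_mul (a : ℂ)).mono hmass fun _ h => h using 2 with c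
  rw [cramer]
  by_cases h : labels p c.1 = ∅
  · rw [if_pos ((hlabels c.1).2 h), if_pos h, one_mul]
  · rw [if_neg fun h' => h ((hlabels c.1).1 h'), if_neg h, Complex.ofReal_zero, zero_mul,
      mul_zero]

open Classical in
variable (K) in
theorem exists_hasMass_mangoldt : ∃ N₀ : ℕ, ∀ N : ℕ, 3 ≤ N → N₀ ≤ N →
    HasMass (fun S : IdealsLE K N → ℂ => IsTypeOne S ∨ IsTypeTwo S ∨ IsNegligible S)
      (6 * Real.log N) (fun c => (mangoldt c.1 : ℂ)) := by
  obtain ⟨C, hC, hcount⟩ := exists_card_le K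
  obtain ⟨N₀, hN₀⟩ := exists_threshold (2 * C) 1 zero_le_one
  refine ⟨N₀, fun N hN hNN => hasMass_mangoldt hN (lt_of_le_of_lt ?_ (hN₀ N hN hNN))⟩
  have hN1 : (1 : ℝ) ≤ N := by exact_mod_cast (by omega : 1 ≤ N)
  have hlog := one_le_log hN
  set x := Real.sqrt (Real.log N) with hx
  have hx0 : 0 ≤ x := Real.sqrt_nonneg _
  have hx2 : Real.log N = x ^ 2 := (Real.sq_sqrt (by linarith)).symm
  have h1 := card_filter_le (N := N) hcount
    (Real.one_le_rpow hN1 (show (0 : ℝ) ≤ 1 / 3 by norm_num)) (P := fun c : IdealsLE K N =>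
      (Ideal.absNorm c.1 : ℝ) ≤ (N : ℝ) ^ (1 / 3 : ℝ)) fun c hc => hc
  have h2 : Real.log N ≤ 2 * Real.exp x := by
    have := Real.quadratic_le_exp_of_nonneg hx0
    nlinarith
  have h3 : (N : ℝ) ^ (1 / 3 : ℝ) ≤ Real.exp (5 / 6 * Real.log N) := by
    rw [Real.rpow_def_of_pos (by linarith)]
    exact Real.exp_le_exp.2 (by linarith)
  calc _ ≤ Real.log N * (C * (N : ℝ) ^ (1 / 3 : ℝ)) := by gcongr
    _ ≤ (2 * Real.exp x) * (C * Real.exp (5 / 6 * Real.log N)) := by gcongr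
    _ = 2 * C * Real.exp (5 / 6 * Real.log N + 1 * x) := by
        rw [Real.exp_add, one_mul]
        ring

end

end Vaughan

theorem mainTheorem11 (K : Type*) [Field K] [NumberField K] :
    ∃ (C : ℝ) (N₀ : ℕ), ∀ N : ℕ, 3 ≤ N → N₀ ≤ N →
      Vaughan.IsCombination
        (fun S : Vaughan.IdealsLE K N → ℂ =>
          Vaughan.IsTypeOne S ∨ Vaughan.IsTypeTwo S ∨ Vaughan.IsNegligible S)
        (C * Real.log N) (fun c => (Vaughan.mangoldt c.1 : ℂ)) ∧
      ∀ B : ℝ, 1 ≤ B →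
        Vaughan.IsCombination
          (fun S : Vaughan.IdealsLE K N → ℂ =>
            Vaughan.IsTypeOne S ∨ Vaughan.IsTypeTwo S ∨ Vaughan.IsNegligible S)
          (C * Real.log N) (fun c => (Vaughan.cramer (Vaughan.sieveLevel B N) c.1 : ℂ)) ∧
        ∀ κ : ℝ, 0 < κ → κ < 1 →
          ∀ z : Option (Vaughan.SiegelZero K κ (Vaughan.sieveLevel B N)),
            Vaughan.IsCombination
              (fun S : Vaughan.IdealsLE K N → ℂ =>
                Vaughan.IsTypeOne S ∨ Vaughan.IsSiegelTwisted S z ∨ Vaughan.IsTypeTwo S ∨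
                  Vaughan.IsNegligible S)
              (C * Real.log N) (fun c => Vaughan.siegel z c.1) := by
  classical
  obtain ⟨N₁, hΛ⟩ := Vaughan.exists_hasMass_mangoldt K
  obtain ⟨C, N₂, hC⟩ := Vaughan.exists_hasMass_cramer K
  refine ⟨max 6 (2 * |C|), max N₁ N₂, fun N hN hNN => ?_⟩
  have hlog : 0 ≤ Real.log N := by linarith [Vaughan.one_le_log hN]
  have hC2 : C * Real.log N + C * Real.log N ≤ max 6 (2 * |C|) * Real.log N := by
    rw [← two_mul, ← mul_assoc]
    gcongr
    exact le_max_of_le_right (by linarith [le_abs_self C])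
  have hC1 : C * Real.log N ≤ max 6 (2 * |C|) * Real.log N := by
    gcongr
    exact le_max_of_le_right (by linarith [le_abs_self C, abs_nonneg C])
  refine ⟨(hΛ N hN ((le_max_left _ _).trans hNN)).mono (by gcongr; exact le_max_left _ _)
    fun _ h => h, fun B hB => ?_⟩
  have key := hC N hN ((le_max_right _ _).trans hNN) B hB
  have hcramer : Vaughan.HasMass (fun S : Vaughan.IdealsLE K N → ℂ =>
      Vaughan.IsTypeOne S ∨ Vaughan.IsTypeTwo S ∨ Vaughan.IsNegligible S) (C * Real.log N)
      (fun c => (Vaughan.cramer (Vaughan.sieveLevel B N) c.1 : ℂ)) := by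
    have := (key (fun _ => 1) (by simp) (by simp) 1 le_rfl).mono le_rfl fun S hS =>
      hS.imp_left Vaughan.isTypeOne_of_isTwistedTypeOne_one
    simpa using this
  refine ⟨hcramer.mono hC1 fun _ h => h, fun κ _ _ z => ?_⟩
  cases z with
  | none => exact hcramer.mono hC1 fun S hS => hS.imp_right Or.inr
  | some z =>
    have htwist := key (z.char.idealValue z.cond)
      (Vaughan.HeckeCharacter.idealValue_mul z.isConductor.1)
      (z.char.norm_idealValue_le z.cond) z.beta z.beta_lt_one.le
    have hsum := (hcramer.mono le_rfl fun S hS => hS.imp_right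
      (Or.inr (a := Vaughan.IsSiegelTwisted S (some z)))).add
      ((htwist.const_mul (-1)).mono le_rfl fun S hS => Or.inr hS)
    rw [norm_neg, norm_one, one_mul] at hsum
    have hfun : (fun c : Vaughan.IdealsLE K N => Vaughan.siegel (some z) c.1) = _ :=
      funext fun c => by
        rw [Vaughan.siegel, mul_sub, mul_one, sub_eq_add_neg, ← neg_one_mul]
    rw [hfun]
    exact hsum.mono hC2 fun _ h => h
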